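/- Let $a,b>0$ with $ab\le 1$ and let $g\in L^2(\mathbb R)$ (complex valued). For $m,n\in\mathbb Z$ let $E_{mb}T_{na}g(t)=e^{2\pi i mbt}g(t-na)$, and for $k\in\mathbb Z$ let $$G_k(t)=\sum_{n\in\mathbb Z} g(t-na)\,\overline{g(t-na-k/b)}$$ (absolutely convergent for a.e. $t$). Let $S$ be the Weyl–Heisenberg frame operator $Sf=\sum_{m,n\in\mathbb Z}\langle f,E_{mb}T_{na}g\rangle E_{mb}T_{na}g$. Let $L_0^\infty$ be the closure in $L^\infty(\mathbb R)$ of the compactly supported functions. For a space $X\subseteq L^p(\mathbb R)$ we say that $S$ extends to a map $T:X\to L^p(\mathbb R)$ if for every $f\in X\cap L^2(\mathbb R)$ the series $Sf$ converges unconditionally in $L^2(\mathbb R)$ and $Tf=Sf$ a.e. **Theorem 7.1.** The following are equivalent: 1. (CC-condition) There is a constant $B>0$ such that $\sum_{k\in\mathbb Z}|G_k(t)|\le B$ for a.e. $t\in\mathbb R$. 2. $S$ extends to a bounded linear operator $L^p(\mathbb R)\to L^p(\mathbb R)$ for every $1\le p<\infty$, and to a bounded linear operator $L_0^\infty\to L^\infty(\mathbb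 R)$. Moreover, suppose that $ab$ is rational, that $(E_{mb}T_{na}g)_{m,n\in\mathbb Z}$ is a frame for $L^2(\mathbb R)$, i.e. there are $A>0$ and $B<\infty$ with $A\|f\|^2\le\sum_{m,n}|\langle f,E_{mb}T_{na}g\rangle|^2\le B\|f\|^2$ for all $f\in L^2(\mathbb R)$, and that $g$ satisfies the uniform CC-condition: for every $\varepsilon>0$ there is $K>0$ such that $\sum_{|k|\ge K}|G_k(t)|<\varepsilon$ for a.e. $t$. Then $S$ extends to an isomorphism (a bounded linear bijection with bounded inverse) of $L^p(\mathbb R)$ onto $L^p(\mathbb R)$ for every $1\le p<\infty$, and of $L_0^\infty$ onto $L_0^\infty$. -/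

import Mathlib

open MeasureTheory Filter Topology
open scoped ENNReal

namespace WeylHeisenberg

noncomputable section

/-- The function `E_{mb} T_{na} g`, that is `t ↦ exp (2 π i m b t) g (t - n a)`. -/
def whFun (a b : ℝ) (g : ℝ → ℂ) (m n : ℤ) (t : ℝ) : ℂ :=
  Complex.exp (2 * Real.pi * Complex.I * (m * b * t : ℝ)) * g (t - n * a)

theorem memLp_whFun (a b : ℝ) {g : ℝ → ℂ} (hg : MemLp g 2 volume) (m n : ℤ) :
    MemLp (whFun a b g m n) 2 volume := by
  have h1 : MemLp (fun t : ℝ => g (t - n * a)) 2 volume :=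
    hg.comp_measurePreserving (measurePreserving_sub_right volume (n * a : ℝ))
  have hc : Continuous fun t : ℝ =>
      Complex.exp (2 * Real.pi * Complex.I * (m * b * t : ℝ)) := by fun_prop
  refine h1.of_le (hc.aestronglyMeasurable.mul h1.aestronglyMeasurable) (ae_of_all _ fun t => ?_)
  have : (2 * Real.pi * Complex.I * (m * b * t : ℝ) : ℂ)
      = ((2 * Real.pi * (m * b * t) : ℝ) : ℂ) * Complex.I := by
    push_cast; ring
  rw [whFun, norm_mul, this, Complex.norm_exp_ofReal_mul_I, one_mul]

/-- The Weyl-Heisenberg system `(E_{mb} T_{na} g)_{m,n}` in `L²(ℝ)`, indexed by the pairs `(m, n)`. -/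
def whSystem (a b : ℝ) (g : Lp ℂ 2 (volume : Measure ℝ)) (i : ℤ × ℤ) :
    Lp ℂ 2 (volume : Measure ℝ) :=
  (memLp_whFun a b (Lp.memLp g) i.1 i.2).toLp (whFun a b g i.1 i.2)

/-- A family `v` in a Hilbert space is a frame: there are `A > 0` and `B < ∞` with
`A ‖f‖² ≤ ∑ |⟨f, v i⟩|² ≤ B ‖f‖²` for all `f`. -/
def IsFrame {ι H : Type*} [NormedAddCommGroup H] [InnerProductSpace ℂ H] (v : ι → H) : Prop :=
  ∃ A B : ℝ, 0 < A ∧ ∀ f : H, Summable (fun i => ‖inner ℂ (v i) f‖ ^ 2) ∧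
    A * ‖f‖ ^ 2 ≤ ∑' i, ‖inner ℂ (v i) f‖ ^ 2 ∧ ∑' i, ‖inner ℂ (v i) f‖ ^ 2 ≤ B * ‖f‖ ^ 2

/-- `G_k(t) = ∑_n g(t - na) conj (g(t - na - k/b))`. For `g ∈ L²(ℝ)` and `a ≠ 0` the series
converges absolutely for almost every `t`. -/
def autoCorr (a b : ℝ) (g : ℝ → ℂ) (k : ℤ) (t : ℝ) : ℂ :=
  ∑' n : ℤ, g (t - n * a) * starRingEnd ℂ (g (t - n * a - k / b))

/-- The CC-condition: `∑_k |G_k(t)| ≤ B` for a.e. `t`, for some constant `B > 0`. -/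
def CCCondition (a b : ℝ) (g : ℝ → ℂ) : Prop :=
  ∃ B : ℝ, 0 < B ∧ ∀ᵐ t : ℝ, ∑' k : ℤ, ‖autoCorr a b g k t‖ₑ ≤ ENNReal.ofReal B

/-- The uniform CC-condition: for every `ε > 0` there is `K > 0` such that
`∑_{|k| ≥ K} |G_k(t)| < ε` for a.e. `t`. -/
def UniformCCCondition (a b : ℝ) (g : ℝ → ℂ) : Prop :=
  ∀ ε : ℝ, 0 < ε → ∃ K : ℕ, 0 < K ∧
    ∀ᵐ t : ℝ, ∑' k : {k : ℤ // (K : ℤ) ≤ |k|}, ‖autoCorr a b g k t‖ₑ < ENNReal.ofReal ε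

/-- `v` is the value at `u ∈ L²(ℝ)` of the frame operator: the series
`∑_{m,n} ⟨u, E_{mb} T_{na} g⟩ E_{mb} T_{na} g` converges unconditionally in `L²(ℝ)` with sum `v`.
(Mathlib's inner product is linear in the second variable.) -/
def IsFrameOpValue (a b : ℝ) (g u v : Lp ℂ 2 (volume : Measure ℝ)) : Prop :=
  HasSum (fun i : ℤ × ℤ => (inner ℂ (whSystem a b g i) u : ℂ) • whSystem a b g i) v

/-- A map `T`, defined on a space `X` of classes of functions in `L^p(ℝ)`, extends the frame
operator: for every `f ∈ X` that also lies in `L²(ℝ)` (as the class `u`), the series of the frame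
operator at `f` converges in `L²(ℝ)` and its sum equals `T f` almost everywhere. -/
def ExtendsFrameOp (a b : ℝ) (g : Lp ℂ 2 (volume : Measure ℝ)) {p : ℝ≥0∞}
    {X : Type*} (incl : X → Lp ℂ p (volume : Measure ℝ)) (T : X → Lp ℂ p (volume : Measure ℝ)) :
    Prop :=
  ∀ (f : X) (u : Lp ℂ 2 (volume : Measure ℝ)), (incl f : ℝ → ℂ) =ᵐ[volume] u →
    ∃ v : Lp ℂ 2 (volume : Measure ℝ), IsFrameOpValue a b g u v ∧ (T f : ℝ → ℂ) =ᵐ[volume] v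

/-- The classes in `L^∞(ℝ)` of functions that vanish a.e. outside a compact set. -/
def compactlySupportedLInfty : Submodule ℂ (Lp ℂ ∞ (volume : Measure ℝ)) where
  carrier := {f | ∃ K : Set ℝ, IsCompact K ∧ ∀ᵐ t : ℝ, t ∉ K → f t = 0}
  zero_mem' := ⟨∅, isCompact_empty, by
    filter_upwards [Lp.coeFn_zero ℂ ∞ (volume : Measure ℝ)] with t ht _
    simp [ht]⟩
  add_mem' := by
    rintro f h ⟨K, hK, hf⟩ ⟨L, hL, hh⟩
    refine ⟨K ∪ L, hK.union hL, ?_⟩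
    filter_upwards [hf, hh, Lp.coeFn_add f h] with t h1 h2 h3 ht
    rw [Set.mem_union, not_or] at ht
    rw [h3, Pi.add_apply, h1 ht.1, h2 ht.2, add_zero]
  smul_mem' := by
    rintro c f ⟨K, hK, hf⟩
    refine ⟨K, hK, ?_⟩
    filter_upwards [hf, Lp.coeFn_smul c f] with t h1 h2 ht
    rw [h2, Pi.smul_apply, h1 ht, smul_zero]

/-- `L_0^∞(ℝ)`: the closure in `L^∞(ℝ)` of the compactly supported functions. -/
def LInftyZero : Submodule ℂ (Lp ℂ ∞ (volume : Measure ℝ)) :=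
  compactlySupportedLInfty.topologicalClosure

end

end WeylHeisenberg

/-!
By Walnut's representation, `b S f (t) = ∑ₖ G_k(t) f(t - k/b)`. Under the CC-condition the rows and
the columns of this kernel are bounded, because `|G_{-k}(t)| = |G_k(t + k/b)|`, so Schur's test
bounds it on every `L^p`. Conversely a bound on `L₀^∞`, tested on functions whose translates by
multiples of `1/b` carry the conjugate phases of finitely many `G_k`, gives the CC-condition.

For the second part let `T = b S`. As `T` is positive and bounded below on `L²`, the estimate
`c ‖u‖ ≤ ‖T u + λ u‖` holds there for all `λ ≥ 0`, and it holds fibrewise on the cosets of `b⁻¹ ℤ`.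
The uniform CC-condition makes the commutators of the kernel with slowly varying weights
`r ^ |j - J|` small; here rationality of `ab` enters, since the `G_k` are `a`-periodic and a coset
of `b⁻¹ ℤ` then meets only finitely many classes modulo `a`. Summing the weighted estimates gives a
lower bound for `T + λ` on every `L^p` and on `L₀^∞`, with a constant independent of `λ`. As `T + λ`
is invertible for large `λ`, this bound carries invertibility down to `λ = 0`.
-/

namespace WeylHeisenberg

open scoped NNReal ComplexConjugate

/-! ### Schur kernels on translates -/

/-- The positive operator `F ↦ ∑ₖ wₖ F (· - k s)` given by a family of weights on the translations
by `s ℤ`. -/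
noncomputable def kerAbs (s : ℝ) (w : ℤ → ℝ → ℝ≥0∞) (F : ℝ → ℝ≥0∞) (t : ℝ) : ℝ≥0∞ :=
  ∑' k : ℤ, w k t * F (t - k * s)

/-- The operator `f ↦ ∑ₖ Γₖ f (· - k s)` given by a kernel on the translations by `s ℤ`; the Walnut
representation of the frame operator has this form. Where the series diverges the value is `0`. -/
noncomputable def kerSum (s : ℝ) (Γ : ℤ → ℝ → ℂ) (f : ℝ → ℂ) (t : ℝ) : ℂ :=
  ∑' k : ℤ, Γ k t * f (t - k * s)

/-- A kernel on the translations by `s ℤ` whose rows and columns are absolutely summable, with sums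
at most `C`: the hypothesis of Schur's test. -/
structure IsSchurKernel (s : ℝ) (Γ : ℤ → ℝ → ℂ) (C : ℝ≥0) : Prop where
  meas : ∀ k, Measurable (Γ k)
  row : ∀ᵐ t : ℝ, ∑' k : ℤ, ‖Γ k t‖ₑ ≤ C
  col : ∀ᵐ t : ℝ, ∑' k : ℤ, ‖Γ k (t + k * s)‖ₑ ≤ C

theorem ae_sub_const {q : ℝ → Prop} (h : ∀ᵐ t : ℝ, q t) (c : ℝ) : ∀ᵐ t : ℝ, q (t - c) :=
  (measurePreserving_sub_right volume c).quasiMeasurePreserving.ae h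

theorem ae_forall_sub {q : ℝ → Prop} (h : ∀ᵐ t : ℝ, q t) (s : ℝ) :
    ∀ᵐ t : ℝ, ∀ k : ℤ, q (t - k * s) :=
  ae_all_iff.2 fun _ => ae_sub_const h _

theorem aemeasurable_comp_sub {β : Type*} [MeasurableSpace β] {F : ℝ → β}
    (hF : AEMeasurable F) (c : ℝ) : AEMeasurable fun t => F (t - c) :=
  hF.comp_quasiMeasurePreserving (measurePreserving_sub_right volume c).quasiMeasurePreserving

theorem inner_le_rpow_mul_tsum_rpow {ι : Type*} (w F : ι → ℝ≥0∞) {r : ℝ} (hr : 1 ≤ r) :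
    ∑' k, w k * F k ≤ (∑' k, w k) ^ (1 - r⁻¹) * (∑' k, w k * F k ^ r) ^ r⁻¹ := by
  have hr' : 0 ≤ 1 - r⁻¹ := sub_nonneg.2 (inv_le_one_of_one_le₀ hr)
  rw [ENNReal.tsum_eq_iSup_sum]
  refine iSup_le fun u => (ENNReal.inner_le_weight_mul_Lp_of_nonneg u hr w F).trans ?_
  gcongr <;> exact ENNReal.sum_le_tsum u

theorem tsum_mul_rpow_le {ι : Type*} (w F : ι → ℝ≥0∞) {C : ℝ≥0∞} {r : ℝ} (hr : 1 ≤ r)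
    (hw : ∑' k, w k ≤ C) : (∑' k, w k * F k) ^ r ≤ C ^ (r - 1) * ∑' k, w k * F k ^ r := by
  have hr0 : 0 < r := one_pos.trans_le hr
  have hr' : 0 ≤ 1 - r⁻¹ := sub_nonneg.2 (inv_le_one_of_one_le₀ hr)
  calc (∑' k, w k * F k) ^ r ≤ (C ^ (1 - r⁻¹) * (∑' k, w k * F k ^ r) ^ r⁻¹) ^ r := by
        gcongr
        exact (inner_le_rpow_mul_tsum_rpow w F hr).trans (by gcongr)
    _ = C ^ (r - 1) * ∑' k, w k * F k ^ r := by
        rw [ENNReal.mul_rpow_of_nonneg _ _ hr0.le, ← ENNReal.rpow_mul, ← ENNReal.rpow_mul,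
          inv_mul_cancel₀ hr0.ne', ENNReal.rpow_one]
        congr 2
        field_simp

theorem ae_lt_top_of_eLpNorm_lt_top {α : Type*} [MeasurableSpace α] {μ : Measure α}
    {F : α → ℝ≥0∞} {p : ℝ≥0∞} (hp : p ≠ 0) (hF : AEMeasurable F μ) (h : eLpNorm F p μ < ∞) :
    ∀ᵐ t ∂μ, F t < ∞ := by
  rcases eq_or_ne p ∞ with rfl | hp'
  · filter_upwards [enorm_ae_le_eLpNormEssSup F μ] with t ht
    exact ht.trans_lt (by rwa [eLpNorm_exponent_top] at h)
  · have h1 := lintegral_rpow_enorm_lt_top_of_eLpNorm_lt_top hp hp' h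
    filter_upwards [ae_lt_top' (hF.pow_const _) h1.ne] with t ht
    exact (ENNReal.rpow_lt_top_iff_of_pos (ENNReal.toReal_pos hp hp')).1 ht

section Schur

variable {s : ℝ} {w : ℤ → ℝ → ℝ≥0∞} {F : ℝ → ℝ≥0∞} {C : ℝ≥0} {p : ℝ≥0∞}

theorem aemeasurable_kerAbs (hw : ∀ k, Measurable (w k)) (hF : AEMeasurable F) :
    AEMeasurable (kerAbs s w F) :=
  AEMeasurable.tsum fun k => (hw k).aemeasurable.mul (aemeasurable_comp_sub hF _)

theorem lintegral_kerAbs_le (hw : ∀ k, Measurable (w k))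
    (col : ∀ᵐ t : ℝ, ∑' k : ℤ, w k (t + k * s) ≤ C) (hF : AEMeasurable F) :
    ∫⁻ t, kerAbs s w F t ≤ C * ∫⁻ t, F t :=
  calc ∫⁻ t, kerAbs s w F t = ∑' k : ℤ, ∫⁻ t, w k t * F (t - k * s) :=
        lintegral_tsum fun k => (hw k).aemeasurable.mul (aemeasurable_comp_sub hF _)
    _ = ∑' k : ℤ, ∫⁻ t, w k (t + k * s) * F t := by
        congr 1 with k
        rw [← lintegral_sub_right_eq_self (fun t => w k (t + k * s) * F t) (k * s)]
        simp only [sub_add_cancel]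
    _ = ∫⁻ t, (∑' k : ℤ, w k (t + k * s)) * F t := by
        simp_rw [← ENNReal.tsum_mul_right]
        exact (lintegral_tsum fun k =>
          ((hw k).comp (measurable_add_const _)).aemeasurable.mul hF).symm
    _ ≤ ∫⁻ t, C * F t := lintegral_mono_ae (col.mono fun t ht => by gcongr)
    _ = C * ∫⁻ t, F t := lintegral_const_mul'' _ hF

theorem lintegral_kerAbs_rpow_le {r : ℝ} (hr : 1 ≤ r) (hw : ∀ k, Measurable (w k))
    (row : ∀ᵐ t : ℝ, ∑' k : ℤ, w k t ≤ C) (col : ∀ᵐ t : ℝ, ∑' k : ℤ, w k (t + k * s) ≤ C)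
    (hF : AEMeasurable F) : ∫⁻ t, kerAbs s w F t ^ r ≤ (C : ℝ≥0∞) ^ r * ∫⁻ t, F t ^ r :=
  calc ∫⁻ t, kerAbs s w F t ^ r
      ≤ ∫⁻ t, (C : ℝ≥0∞) ^ (r - 1) * kerAbs s w (fun u => F u ^ r) t :=
        lintegral_mono_ae (row.mono fun t ht => tsum_mul_rpow_le _ _ hr ht)
    _ = (C : ℝ≥0∞) ^ (r - 1) * ∫⁻ t, kerAbs s w (fun u => F u ^ r) t :=
        lintegral_const_mul'' _ (aemeasurable_kerAbs hw (hF.pow_const r))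
    _ ≤ (C : ℝ≥0∞) ^ (r - 1) * (C * ∫⁻ t, F t ^ r) := by
        gcongr
        exact lintegral_kerAbs_le hw col (hF.pow_const r)
    _ = (C : ℝ≥0∞) ^ r * ∫⁻ t, F t ^ r := by
        rw [← mul_assoc]
        congr 1
        conv_rhs => rw [← sub_add_cancel r 1,
          ENNReal.rpow_add_of_nonneg _ _ (sub_nonneg.2 hr) zero_le_one, ENNReal.rpow_one]

theorem eLpNormEssSup_kerAbs_le (row : ∀ᵐ t : ℝ, ∑' k : ℤ, w k t ≤ C) :
    eLpNormEssSup (kerAbs s w F) volume ≤ C * eLpNormEssSup F volume := by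
  refine eLpNormEssSup_le_of_ae_enorm_bound ?_
  filter_upwards [row, ae_forall_sub (enorm_ae_le_eLpNormEssSup F volume) s] with t hrow hF
  calc kerAbs s w F t ≤ ∑' k : ℤ, w k t * eLpNormEssSup F volume := by
        unfold kerAbs; gcongr with k; exact hF k
    _ = (∑' k : ℤ, w k t) * eLpNormEssSup F volume := ENNReal.tsum_mul_right
    _ ≤ C * eLpNormEssSup F volume := by gcongr

theorem eLpNorm_kerAbs_le (hp : 1 ≤ p) (hw : ∀ k, Measurable (w k))
    (row : ∀ᵐ t : ℝ, ∑' k : ℤ, w k t ≤ C) (col : ∀ᵐ t : ℝ, ∑' k : ℤ, w k (t + k * s) ≤ C)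
    (hF : AEMeasurable F) : eLpNorm (kerAbs s w F) p ≤ C * eLpNorm F p := by
  rcases eq_or_ne p ∞ with rfl | hp'
  · simpa only [eLpNorm_exponent_top] using eLpNormEssSup_kerAbs_le row
  have hp0 : p ≠ 0 := (zero_lt_one.trans_le hp).ne'
  have hr : 1 ≤ p.toReal := by simpa using ENNReal.toReal_mono hp' hp
  have hr0 : 0 < p.toReal := one_pos.trans_le hr
  simp only [eLpNorm_eq_lintegral_rpow_enorm_toReal hp0 hp', enorm_eq_self]
  calc (∫⁻ t, kerAbs s w F t ^ p.toReal) ^ (1 / p.toReal)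
      ≤ ((C : ℝ≥0∞) ^ p.toReal * ∫⁻ t, F t ^ p.toReal) ^ (1 / p.toReal) := by
        gcongr
        exact lintegral_kerAbs_rpow_le hr hw row col hF
    _ = _ := by
        rw [ENNReal.mul_rpow_of_nonneg _ _ (by positivity), ← ENNReal.rpow_mul,
          mul_one_div_cancel hr0.ne', ENNReal.rpow_one]

end Schur

section KerSum

variable {s : ℝ} {Γ : ℤ → ℝ → ℂ} {C : ℝ≥0} {f h : ℝ → ℂ} {p : ℝ≥0∞}

theorem enorm_kerSum_le (t : ℝ) :
    ‖kerSum s Γ f t‖ₑ ≤ kerAbs s (fun k t => ‖Γ k t‖ₑ) (fun t => ‖f t‖ₑ) t := by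
  simpa only [kerSum, kerAbs, ← enorm_mul] using enorm_tsum_le_tsum_enorm

theorem aestronglyMeasurable_kerSum (hΓ : ∀ k, Measurable (Γ k))
    (hf : AEStronglyMeasurable f) : AEStronglyMeasurable (kerSum s Γ f) :=
  AEMeasurable.aestronglyMeasurable <| AEMeasurable.tsum fun k =>
    (hΓ k).aemeasurable.mul (aemeasurable_comp_sub hf.aemeasurable _)

theorem kerSum_congr_ae (hfh : f =ᵐ[volume] h) : kerSum s Γ f =ᵐ[volume] kerSum s Γ h := by
  filter_upwards [ae_forall_sub hfh s] with t ht
  simp only [kerSum, ht]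

theorem IsSchurKernel.eLpNorm_kerAbs_le (hΓ : IsSchurKernel s Γ C) (hp : 1 ≤ p)
    (hf : AEStronglyMeasurable f) :
    eLpNorm (kerAbs s (fun k t => ‖Γ k t‖ₑ) (fun t => ‖f t‖ₑ)) p ≤ C * eLpNorm f p := by
  simpa only [eLpNorm_enorm] using WeylHeisenberg.eLpNorm_kerAbs_le (F := fun t => ‖f t‖ₑ) hp
    (fun k => (hΓ.meas k).enorm) hΓ.row hΓ.col hf.enorm

theorem IsSchurKernel.eLpNorm_kerSum_le (hΓ : IsSchurKernel s Γ C) (hp : 1 ≤ p)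
    (hf : AEStronglyMeasurable f) : eLpNorm (kerSum s Γ f) p ≤ C * eLpNorm f p :=
  (eLpNorm_mono_enorm fun t => (enorm_kerSum_le t).trans_eq (enorm_eq_self _).symm).trans
    (hΓ.eLpNorm_kerAbs_le hp hf)

theorem IsSchurKernel.memLp_kerSum (hΓ : IsSchurKernel s Γ C) (hp : 1 ≤ p)
    (hf : MemLp f p) : MemLp (kerSum s Γ f) p :=
  ⟨aestronglyMeasurable_kerSum hΓ.meas hf.1,
    (hΓ.eLpNorm_kerSum_le hp hf.1).trans_lt (ENNReal.mul_lt_top ENNReal.coe_lt_top hf.2)⟩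

theorem IsSchurKernel.summable_ae (hΓ : IsSchurKernel s Γ C) (hp : 1 ≤ p)
    (hf : MemLp f p) : ∀ᵐ t : ℝ, Summable fun k : ℤ => Γ k t * f (t - k * s) := by
  have hlt := (hΓ.eLpNorm_kerAbs_le hp hf.1).trans_lt (ENNReal.mul_lt_top ENNReal.coe_lt_top hf.2)
  filter_upwards [ae_lt_top_of_eLpNorm_lt_top (zero_lt_one.trans_le hp).ne'
    (aemeasurable_kerAbs (fun k => (hΓ.meas k).enorm) hf.1.enorm) hlt] with t ht
  refine Summable.of_norm (tsum_enorm_ne_top_iff_summable_norm.1 ?_)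
  simpa only [kerAbs, ← enorm_mul] using ht.ne

/-- The bounded operator on `L^p`, `1 ≤ p ≤ ∞`, given by a Schur kernel. -/
noncomputable def IsSchurKernel.toCLM (hΓ : IsSchurKernel s Γ C) (p : ℝ≥0∞) [hp : Fact (1 ≤ p)] :
    Lp ℂ p (volume : Measure ℝ) →L[ℂ] Lp ℂ p (volume : Measure ℝ) :=
  LinearMap.mkContinuous
    { toFun := fun f => (hΓ.memLp_kerSum hp.out (Lp.memLp f)).toLp
      map_add' := fun f h => by
        rw [← MemLp.toLp_add, MemLp.toLp_eq_toLp_iff]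
        filter_upwards [ae_forall_sub (Lp.coeFn_add f h) s,
          hΓ.summable_ae hp.out (Lp.memLp f), hΓ.summable_ae hp.out (Lp.memLp h)] with t h1 h2 h3
        simp only [kerSum, h1, Pi.add_apply, mul_add, h2.tsum_add h3]
      map_smul' := fun c f => by
        rw [RingHom.id_apply, ← MemLp.toLp_const_smul, MemLp.toLp_eq_toLp_iff]
        filter_upwards [ae_forall_sub (Lp.coeFn_smul c f) s] with t h1
        simp only [kerSum, h1, Pi.smul_apply, smul_eq_mul, ← tsum_mul_left, mul_left_comm] }
    C fun f => by
      simp only [LinearMap.coe_mk, AddHom.coe_mk]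
      rw [Lp.norm_toLp, Lp.norm_def, ← ENNReal.coe_toReal C, ← ENNReal.toReal_mul]
      exact ENNReal.toReal_mono (ENNReal.mul_ne_top ENNReal.coe_ne_top (Lp.eLpNorm_ne_top f))
        (hΓ.eLpNorm_kerSum_le hp.out (Lp.aestronglyMeasurable f))

theorem IsSchurKernel.toCLM_ae (hΓ : IsSchurKernel s Γ C) [hp : Fact (1 ≤ p)]
    (f : Lp ℂ p (volume : Measure ℝ)) : hΓ.toCLM p f =ᵐ[volume] kerSum s Γ f :=
  MemLp.coeFn_toLp (hΓ.memLp_kerSum hp.out (Lp.memLp f))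

end KerSum

/-- The rows of the kernel `Γ` have uniformly small tails. -/
def TightRows (Γ : ℤ → ℝ → ℂ) : Prop :=
  ∀ ε : ℝ, 0 < ε → ∃ K : ℕ, ∀ᵐ t : ℝ, ∑' k : {k : ℤ // (K : ℤ) ≤ |k|}, ‖Γ k t‖ₑ ≤ ENNReal.ofReal ε

/-- The kernel `Γ` with the entries `Γₖ`, `|k| ≥ K`, replaced by `0`. -/
noncomputable def truncKer (Γ : ℤ → ℝ → ℂ) (K : ℕ) (k : ℤ) (t : ℝ) : ℂ :=
  if (K : ℤ) ≤ |k| then 0 else Γ k t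

section TruncKer

variable {s : ℝ} {Γ : ℤ → ℝ → ℂ} {C : ℝ≥0}

theorem enorm_truncKer_le (K : ℕ) (k : ℤ) (t : ℝ) : ‖truncKer Γ K k t‖ₑ ≤ ‖Γ k t‖ₑ := by
  unfold truncKer
  split_ifs <;> simp

theorem IsSchurKernel.truncKer (hΓ : IsSchurKernel s Γ C) (K : ℕ) :
    IsSchurKernel s (truncKer Γ K) C where
  meas k := by
    unfold WeylHeisenberg.truncKer
    split_ifs
    exacts [measurable_const, hΓ.meas k]
  row := hΓ.row.mono fun t ht =>
    (ENNReal.tsum_le_tsum fun k => enorm_truncKer_le K k t).trans ht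
  col := hΓ.col.mono fun t ht =>
    (ENNReal.tsum_le_tsum fun k => enorm_truncKer_le K k (t + k * s)).trans ht

theorem IsSchurKernel.toCLM_truncKer_mem (hΓ : IsSchurKernel s Γ C) (K : ℕ)
    {f : Lp ℂ ∞ (volume : Measure ℝ)} (hf : f ∈ compactlySupportedLInfty) :
    (hΓ.truncKer K).toCLM ∞ f ∈ compactlySupportedLInfty := by
  obtain ⟨L, hL, hfL⟩ := hf
  refine ⟨⋃ k ∈ Finset.Icc (-(K : ℤ)) K, (fun x : ℝ => x + k * s) '' L,
    Finset.isCompact_biUnion _ fun k _ => hL.image (by fun_prop), ?_⟩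
  filter_upwards [(hΓ.truncKer K).toCLM_ae f, ae_forall_sub hfL s] with t hval hvan ht
  rw [hval, kerSum]
  refine (tsum_congr fun k => ?_).trans tsum_zero
  by_cases hk : (K : ℤ) ≤ |k|
  · simp [WeylHeisenberg.truncKer, hk]
  · rw [hvan k, mul_zero]
    intro hmem
    refine ht (Set.mem_iUnion₂.2 ⟨k, ?_, t - k * s, hmem, sub_add_cancel _ _⟩)
    exact Finset.mem_Icc.2 (abs_le.1 (not_le.1 hk).le)

theorem enorm_kerSum_sub_kerSum_truncKer_le {f : ℝ → ℂ} {M : ℝ≥0∞} {K : ℕ} {t : ℝ}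
    (hf : ∀ k : ℤ, ‖f (t - k * s)‖ₑ ≤ M) (h : Summable fun k : ℤ => Γ k t * f (t - k * s))
    (h' : Summable fun k : ℤ => truncKer Γ K k t * f (t - k * s)) :
    ‖kerSum s Γ f t - kerSum s (truncKer Γ K) f t‖ₑ
      ≤ (∑' k : {k : ℤ // (K : ℤ) ≤ |k|}, ‖Γ k t‖ₑ) * M := by
  rw [kerSum, kerSum, ← h.tsum_sub h', ← ENNReal.tsum_mul_right]
  refine (enorm_tsum_le_tsum_enorm.trans (ENNReal.tsum_le_tsum fun k => ?_)).trans_eq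
    (tsum_subtype {k : ℤ | (K : ℤ) ≤ |k|} fun k => ‖Γ k t‖ₑ * M).symm
  by_cases hk : (K : ℤ) ≤ |k|
  · simpa [truncKer, hk] using mul_le_mul_right (hf k) _
  · simp [truncKer, hk]

theorem IsSchurKernel.norm_toCLM_sub_toCLM_truncKer_le (hΓ : IsSchurKernel s Γ C) {K : ℕ} {δ : ℝ}
    (hδ : 0 ≤ δ)
    (htail : ∀ᵐ t : ℝ, ∑' k : {k : ℤ // (K : ℤ) ≤ |k|}, ‖Γ k t‖ₑ ≤ ENNReal.ofReal δ)
    (f : Lp ℂ ∞ (volume : Measure ℝ)) :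
    ‖hΓ.toCLM ∞ f - (hΓ.truncKer K).toCLM ∞ f‖ ≤ δ * ‖f‖ := by
  rw [Lp.norm_def, Lp.norm_def, ← ENNReal.toReal_ofReal hδ, ← ENNReal.toReal_mul]
  refine ENNReal.toReal_mono (ENNReal.mul_ne_top ENNReal.ofReal_ne_top (Lp.eLpNorm_ne_top f)) ?_
  rw [eLpNorm_exponent_top, eLpNorm_exponent_top]
  refine eLpNormEssSup_le_of_ae_enorm_bound ?_
  filter_upwards [htail, hΓ.toCLM_ae f, (hΓ.truncKer K).toCLM_ae f, Lp.coeFn_sub (hΓ.toCLM ∞ f) _,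
    hΓ.summable_ae le_top (Lp.memLp f), (hΓ.truncKer K).summable_ae le_top (Lp.memLp f),
    ae_forall_sub (enorm_ae_le_eLpNormEssSup f volume) s] with t h1 h2 h3 h4 h5 h6 h7
  rw [h4, Pi.sub_apply, h2, h3]
  exact (enorm_kerSum_sub_kerSum_truncKer_le h7 h5 h6).trans (by gcongr)

theorem IsSchurKernel.toCLM_mem_LInftyZero (hΓ : IsSchurKernel s Γ C) (htight : TightRows Γ)
    {f : Lp ℂ ∞ (volume : Measure ℝ)} (hf : f ∈ LInftyZero) : hΓ.toCLM ∞ f ∈ LInftyZero := by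
  refine closure_closure.subset (map_mem_closure (hΓ.toCLM ∞).continuous hf fun f hf => ?_)
  refine Metric.mem_closure_iff.2 fun ε hε => ?_
  obtain ⟨δ, hδ, hδε⟩ : ∃ δ > 0, δ * ‖f‖ < ε := by
    simpa only [mul_comm] using exists_pos_mul_lt hε ‖f‖
  obtain ⟨K, hK⟩ := htight δ hδ
  refine ⟨(hΓ.truncKer K).toCLM ∞ f, hΓ.toCLM_truncKer_mem K hf, ?_⟩
  rw [dist_eq_norm]
  exact (hΓ.norm_toCLM_sub_toCLM_truncKer_le hδ.le hK f).trans_lt hδε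

end TruncKer

/-! ### Periodization -/

theorem tsum_sub_periodic {α : Type*} [AddCommMonoid α] [TopologicalSpace α] (s : ℝ) (φ : ℝ → α)
    (j : ℤ) (t : ℝ) : ∑' k : ℤ, φ (t - j * s - k * s) = ∑' k : ℤ, φ (t - k * s) := by
  rw [← (Equiv.addLeft j).tsum_eq fun k : ℤ => φ (t - k * s)]
  simp only [Equiv.coe_addLeft, Int.cast_add, add_mul, sub_sub]

theorem preimage_sub_Ioc_zsmul (s : ℝ) (k : ℤ) :
    (fun t : ℝ => t - k * s) ⁻¹' Set.Ioc (-k • s) ((-k + 1) • s) = Set.Ioc 0 s := by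
  rw [Set.preimage_sub_const_Ioc]
  congr 1 <;> push_cast [zsmul_eq_mul] <;> ring

theorem lintegral_eq_setLIntegral_tsum_sub {s : ℝ} (hs : 0 < s) {F : ℝ → ℝ≥0∞}
    (hF : AEMeasurable F) : ∫⁻ t, F t = ∫⁻ t in Set.Ioc 0 s, ∑' k : ℤ, F (t - k * s) :=
  calc ∫⁻ t, F t = ∑' k : ℤ, ∫⁻ t in Set.Ioc (k • s) ((k + 1) • s), F t := by
        rw [← lintegral_iUnion (fun k : ℤ => measurableSet_Ioc) (Set.pairwise_disjoint_Ioc_zsmul s),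
          iUnion_Ioc_zsmul hs, setLIntegral_univ]
    _ = ∑' k : ℤ, ∫⁻ t in Set.Ioc (-k • s) ((-k + 1) • s), F t :=
        ((Equiv.neg ℤ).tsum_eq _).symm
    _ = ∑' k : ℤ, ∫⁻ t in Set.Ioc 0 s, F (t - k * s) := by
        congr 1 with k
        rw [← (measurePreserving_sub_right volume (k * s : ℝ)).setLIntegral_comp_preimage_emb
          (measurableEmbedding_subRight _) F, preimage_sub_Ioc_zsmul]
    _ = ∫⁻ t in Set.Ioc 0 s, ∑' k : ℤ, F (t - k * s) :=
        (lintegral_tsum fun k => (aemeasurable_comp_sub hF _).restrict).symm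

theorem integral_eq_tsum_setIntegral_sub {s : ℝ} (hs : 0 < s) {F : ℝ → ℂ} (hF : Integrable F) :
    ∫ t, F t = ∑' k : ℤ, ∫ t in Set.Ioc 0 s, F (t - k * s) := by
  have hcells := hasSum_integral_iUnion (μ := volume) (f := F)
    (fun i : ℤ => measurableSet_Ioc (a := i • s) (b := (i + 1) • s))
    (Set.pairwise_disjoint_Ioc_zsmul s) hF.integrableOn
  rw [iUnion_Ioc_zsmul hs, setIntegral_univ] at hcells
  rw [← hcells.tsum_eq, ← (Equiv.neg ℤ).tsum_eq]
  congr 1 with k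
  rw [Equiv.neg_apply, ← (measurePreserving_sub_right volume (k * s : ℝ)).setIntegral_preimage_emb
    (measurableEmbedding_subRight _) F, preimage_sub_Ioc_zsmul]

theorem setIntegral_tsum_sub {s : ℝ} (hs : 0 < s) {F : ℝ → ℂ} (hF : Integrable F) :
    ∫ t in Set.Ioc 0 s, ∑' k : ℤ, F (t - k * s) = ∫ t, F t := by
  have hshift (k : ℤ) : AEStronglyMeasurable (fun t => F (t - k * s))
      (volume.restrict (Set.Ioc 0 s)) := (hF.comp_sub_right _).aestronglyMeasurable.restrict
  rw [integral_eq_tsum_setIntegral_sub hs hF, integral_tsum hshift]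
  rw [← lintegral_tsum fun k => (hshift k).enorm,
    ← lintegral_eq_setLIntegral_tsum_sub hs hF.aestronglyMeasurable.enorm]
  exact hF.2.ne

theorem setIntegral_tsum_sub_mul {s : ℝ} (hs : 0 < s) {φ P : ℝ → ℂ}
    (hP : ∀ (k : ℤ) t, P (t - k * s) = P t) (hi : Integrable fun t => φ t * P t) :
    ∫ t in Set.Ioc 0 s, (∑' k : ℤ, φ (t - k * s)) * P t = ∫ t, φ t * P t := by
  rw [← setIntegral_tsum_sub hs hi]
  simp only [hP, tsum_mul_right]

theorem ae_of_forall_ae_Ioc_sub {q : ℝ → Prop} {s : ℝ} (hs : 0 < s)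
    (h : ∀ᵐ t ∂volume.restrict (Set.Ioc 0 s), ∀ k : ℤ, q (t - k * s)) : ∀ᵐ t : ℝ, q t := by
  rw [← Measure.restrict_univ (μ := volume), ← iUnion_Ioc_zsmul hs, ae_restrict_iUnion_iff]
  intro k
  have hk := ((ae_restrict_iff' measurableSet_Ioc).1 h)
  rw [ae_restrict_iff' measurableSet_Ioc]
  filter_upwards [ae_sub_const hk (k * s)] with t ht hmem
  have := ht (by
    rw [Set.mem_Ioc, zsmul_eq_mul, zsmul_eq_mul] at hmem
    push_cast at hmem
    exact ⟨by linarith [hmem.1], by linarith [hmem.2]⟩) (-k)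
  simpa using this

/-- Invariance of a subset of the line under the translations by `s ℤ`. -/
def IsTranslInvariant (s : ℝ) (E : Set ℝ) : Prop :=
  ∀ (k : ℤ) (t : ℝ), t - k * s ∈ E ↔ t ∈ E

theorem IsTranslInvariant.setLIntegral_eq {s : ℝ} {E : Set ℝ} (hE : IsTranslInvariant s E)
    (hs : 0 < s) (hEm : MeasurableSet E) {F : ℝ → ℝ≥0∞} (hF : Measurable F) :
    ∫⁻ t in E, F t = ∫⁻ t in Set.Ioc 0 s, E.indicator (fun t => ∑' k : ℤ, F (t - k * s)) t := by
  rw [← lintegral_indicator hEm,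
    lintegral_eq_setLIntegral_tsum_sub hs (hF.indicator hEm).aemeasurable]
  congr 1 with t
  by_cases ht : t ∈ E <;> simp [Set.indicator, hE _ t, ht]

theorem ae_tsum_sub_le_of_setLIntegral_le {s : ℝ} (hs : 0 < s) {F G : ℝ → ℝ≥0∞}
    (hF : Measurable F) (hG : Measurable G) (hfin : ∫⁻ t, G t ≠ ∞)
    (h : ∀ E : Set ℝ, MeasurableSet E → IsTranslInvariant s E →
      ∫⁻ t in E, F t ≤ ∫⁻ t in E, G t) :
    ∀ᵐ t : ℝ, ∑' k : ℤ, F (t - k * s) ≤ ∑' k : ℤ, G (t - k * s) := by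
  set PF : ℝ → ℝ≥0∞ := fun t => ∑' k : ℤ, F (t - k * s)
  set PG : ℝ → ℝ≥0∞ := fun t => ∑' k : ℤ, G (t - k * s)
  have hPF : Measurable PF := Measurable.tsum fun k => hF.comp (measurable_sub_const _)
  have hPG : Measurable PG := Measurable.tsum fun k => hG.comp (measurable_sub_const _)
  set E : Set ℝ := {t | PG t < PF t}
  have hEm : MeasurableSet E := measurableSet_lt hPG hPF
  have hE : IsTranslInvariant s E := fun k t => by
    simp only [E, PF, PG, Set.mem_ofPred_eq, tsum_sub_periodic]
  have hint : ∫⁻ t in Set.Ioc 0 s, E.indicator PF t ≤ ∫⁻ t in Set.Ioc 0 s, E.indicator PG t := by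
    simpa only [hE.setLIntegral_eq hs hEm hF, hE.setLIntegral_eq hs hEm hG] using h E hEm hE
  have hPGfin : ∫⁻ t in Set.Ioc 0 s, E.indicator PG t ≠ ∞ := by
    rw [← hE.setLIntegral_eq hs hEm hG]
    exact ((setLIntegral_le_lintegral E G).trans_lt hfin.lt_top).ne
  have heq := ae_eq_of_ae_le_of_lintegral_le
    (ae_of_all _ fun t => Set.indicator_le_indicator' fun ht : t ∈ E => ht.le) hPGfin
    (hPF.indicator hEm).aemeasurable hint
  refine ae_of_forall_ae_Ioc_sub hs (heq.mono fun t ht k => ?_)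
  have htE : t ∉ E := fun htE => by
    simp only [Set.indicator_of_mem htE] at ht
    exact htE.ne ht
  exact not_lt.1 ((hE k t).not.2 htE)

theorem ae_tsum_sub_lt_top {s : ℝ} (hs : 0 < s) {F : ℝ → ℝ≥0∞} (hF : AEMeasurable F)
    (hfin : ∫⁻ t, F t ≠ ∞) : ∀ᵐ t : ℝ, ∑' k : ℤ, F (t - k * s) < ∞ := by
  refine ae_of_forall_ae_Ioc_sub hs ?_
  simp only [tsum_sub_periodic, forall_const]
  refine ae_lt_top' (AEMeasurable.tsum fun k => (aemeasurable_comp_sub hF _).restrict) ?_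
  rwa [← lintegral_eq_setLIntegral_tsum_sub hs hF]

/-- A finite set containing every `k` for which `k s` has absolute value at most `R`. -/
noncomputable def meetSet (s R : ℝ) : Finset ℤ := Finset.Icc (-⌈R / s⌉) ⌈R / s⌉

section MeetSet

variable {s R R' t : ℝ} {k : ℤ}

theorem lt_abs_mul_of_notMem_meetSet (hs : 0 < s) (hk : k ∉ meetSet s R) : R < |k * s| := by
  rw [abs_mul, abs_of_pos hs, ← div_lt_iff₀ hs]
  by_contra! hcon
  have hle := abs_le.1 (hcon.trans (Int.le_ceil _))
  exact hk (Finset.mem_Icc.2 ⟨by exact_mod_cast hle.1, by exact_mod_cast hle.2⟩)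

theorem lt_abs_sub_of_notMem_meetSet (hs : 0 < s) (ht : |t| ≤ R') (hk : k ∉ meetSet s (R + R')) :
    R < |t - k * s| := by
  have := abs_sub_abs_le_abs_sub (k * s) t
  rw [abs_sub_comm] at this
  linarith [lt_abs_mul_of_notMem_meetSet hs hk]

theorem tsum_indicator_Icc_sub_le (hs : 0 < s) (ht : |t| ≤ R') :
    ∑' k : ℤ, (Set.Icc (-R) R).indicator (fun _ => (1 : ℝ≥0∞)) (t - k * s)
      ≤ (meetSet s (R + R')).card := by
  have hout : ∀ k ∉ meetSet s (R + R'),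
      (Set.Icc (-R) R).indicator (fun _ => (1 : ℝ≥0∞)) (t - k * s) = 0 := fun k hk =>
    Set.indicator_of_notMem (fun hmem : _ ∈ Set.Icc (-R) R =>
      (abs_le.2 hmem).not_gt (lt_abs_sub_of_notMem_meetSet hs ht hk)) _
  rw [tsum_eq_sum hout]
  refine (Finset.sum_le_card_nsmul _ _ 1 fun k _ => ?_).trans_eq (by simp)
  exact Set.indicator_apply_le' (fun _ => le_rfl) fun _ => zero_le

theorem abs_le_of_mem_Ioc (ht : t ∈ Set.Ioc 0 s) : |t| ≤ s :=
  (abs_of_pos ht.1).trans_le ht.2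

theorem setLIntegral_Icc_tsum_sub_le (hs : 0 < s) {F : ℝ → ℝ≥0∞} (hF : AEMeasurable F) :
    ∫⁻ t in Set.Icc (-R) R, ∑' k : ℤ, F (t - k * s)
      ≤ (meetSet s (R + s)).card * ∫⁻ t, F t := by
  have hm : AEMeasurable fun t => ∑' k : ℤ, F (t - k * s) :=
    AEMeasurable.tsum fun k => aemeasurable_comp_sub hF _
  rw [← lintegral_indicator measurableSet_Icc,
    lintegral_eq_setLIntegral_tsum_sub hs (hm.indicator measurableSet_Icc),
    lintegral_eq_setLIntegral_tsum_sub hs hF, ← lintegral_const_mul'' _ hm.restrict]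
  refine setLIntegral_mono' measurableSet_Ioc fun t ht => ?_
  calc ∑' j : ℤ, (Set.Icc (-R) R).indicator (fun t => ∑' k : ℤ, F (t - k * s)) (t - j * s)
      = (∑' j : ℤ, (Set.Icc (-R) R).indicator (fun _ => (1 : ℝ≥0∞)) (t - j * s))
          * ∑' k : ℤ, F (t - k * s) := by
        simp only [Set.indicator_apply, tsum_sub_periodic, ← ENNReal.tsum_mul_right, ite_mul,
          one_mul, zero_mul]
    _ ≤ (meetSet s (R + s)).card * ∑' k : ℤ, F (t - k * s) := by
        gcongr
        exact tsum_indicator_Icc_sub_le hs (abs_le_of_mem_Ioc ht)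

end MeetSet

/-! ### Poisson summation -/

theorem hasSum_fourierCoeff_mul_conj {T : ℝ} [hT : Fact (0 < T)]
    (f h : Lp ℂ 2 (@AddCircle.haarAddCircle T hT)) :
    HasSum (fun i => fourierCoeff f i * conj (fourierCoeff h i))
      (∫ t : AddCircle T, f t * conj (h t) ∂AddCircle.haarAddCircle) := by
  have hinner (x : Lp ℂ 2 (@AddCircle.haarAddCircle T hT)) (i : ℤ) :
      inner ℂ (fourierBasis (T := T) i) x = fourierCoeff x i := by
    rw [← HilbertBasis.repr_apply_apply, fourierBasis_repr]
  convert! (fourierBasis (T := T)).hasSum_inner_mul_inner h f using 1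
  ext i
  rw [hinner, ← inner_conj_symm h, hinner, mul_comm]

theorem hasSum_fourierCoeffOn_mul_conj {a b : ℝ} {f h : ℝ → ℂ} (hab : a < b)
    (hf : MemLp f 2 (volume.restrict (Set.Ioc a b)))
    (hh : MemLp h 2 (volume.restrict (Set.Ioc a b))) :
    HasSum (fun i => fourierCoeffOn hab f i * conj (fourierCoeffOn hab h i))
      ((b - a)⁻¹ • ∫ x in a..b, f x * conj (h x)) := by
  have := Fact.mk (sub_pos.2 hab)
  rw [← add_sub_cancel a b] at hf hh
  have hf' := hf.memLp_liftIoc.haarAddCircle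
  have hh' := hh.memLp_liftIoc.haarAddCircle
  convert hasSum_fourierCoeff_mul_conj hf'.toLp hh'.toLp using 1
  · ext i
    rw [fourierCoeff_congr_ae hf'.coeFn_toLp, fourierCoeff_congr_ae hh'.coeFn_toLp,
      fourierCoeff_liftIoc_eq, fourierCoeff_liftIoc_eq]
    simp only [add_sub_cancel]
  · nth_rw 2 [← add_sub_cancel a b]
    rw [← AddCircle.integral_liftIoc_eq_intervalIntegral, ← AddCircle.integral_haarAddCircle]
    apply integral_congr_ae
    filter_upwards [hf'.coeFn_toLp, hh'.coeFn_toLp] with x hx hx'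
    rw [hx, hx']
    rfl

/-- The character `t ↦ exp (-2 π i m t / s)` of `ℝ / s ℤ`. -/
noncomputable def chr (s : ℝ) (m : ℤ) (t : ℝ) : ℂ :=
  Complex.exp (-(2 * Real.pi * Complex.I * (m * t / s : ℝ)))

theorem norm_chr (s : ℝ) (m : ℤ) (t : ℝ) : ‖chr s m t‖ = 1 := by
  rw [chr, show (-(2 * Real.pi * Complex.I * (m * t / s : ℝ)) : ℂ)
    = ((-(2 * Real.pi * (m * t / s)) : ℝ) : ℂ) * Complex.I by push_cast; ring,
    Complex.norm_exp_ofReal_mul_I]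

theorem continuous_chr (s : ℝ) (m : ℤ) : Continuous (chr s m) := by
  unfold chr
  fun_prop

theorem chr_sub {s : ℝ} (hs : s ≠ 0) (m k : ℤ) (t : ℝ) : chr s m (t - k * s) = chr s m t := by
  have hs' : (s : ℂ) ≠ 0 := by exact_mod_cast hs
  refine Complex.exp_eq_exp_iff_exists_int.2 ⟨m * k, ?_⟩
  push_cast
  field_simp
  ring

theorem fourierCoeffOn_eq_chr {s : ℝ} (hs : 0 < s) (f : ℝ → ℂ) (m : ℤ) :
    fourierCoeffOn hs f m = (s : ℂ)⁻¹ * ∫ t in Set.Ioc 0 s, f t * chr s m t := by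
  rw [fourierCoeffOn_eq_integral, intervalIntegral.integral_of_le hs.le]
  simp only [sub_zero, one_div, Complex.real_smul, Complex.ofReal_inv]
  congr 2 with t
  rw [fourier_coe_apply, smul_eq_mul, mul_comm, chr]
  congr 2
  push_cast
  ring

section Poisson

variable {s R : ℝ} {φ ψ : ℝ → ℂ}

theorem tsum_sub_eq_sum_meetSet (hs : 0 < s) (hφ : ∀ t, R < |t| → φ t = 0) {R' t : ℝ}
    (ht : |t| ≤ R') : ∑' k : ℤ, φ (t - k * s) = ∑ k ∈ meetSet s (R + R'), φ (t - k * s) :=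
  tsum_eq_sum fun _ hk => hφ _ (lt_abs_sub_of_notMem_meetSet hs ht hk)

theorem memLp_tsum_sub (hs : 0 < s) (hφ : ∀ t, R < |t| → φ t = 0) {p : ℝ≥0∞} (hφp : MemLp φ p)
    (R' : ℝ) : MemLp (fun t => ∑' k : ℤ, φ (t - k * s)) p
      (volume.restrict (Set.Icc (-R') R')) := by
  have hsum : MemLp (fun t => ∑ k ∈ meetSet s (R + R'), φ (t - k * s)) p
      (volume.restrict (Set.Icc (-R') R')) :=
    (memLp_finsetSum (f := fun (k : ℤ) t => φ (t - k * s)) _ fun k _ =>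
      hφp.comp_measurePreserving (measurePreserving_sub_right volume (k * s : ℝ))).restrict _
  refine hsum.ae_eq ?_
  filter_upwards [ae_restrict_mem measurableSet_Icc] with t ht
  exact (tsum_sub_eq_sum_meetSet hs hφ (abs_le.2 ht)).symm

theorem memLp_tsum_sub_Ioc (hs : 0 < s) (hφ : ∀ t, R < |t| → φ t = 0) {p : ℝ≥0∞}
    (hφp : MemLp φ p) :
    MemLp (fun t => ∑' k : ℤ, φ (t - k * s)) p (volume.restrict (Set.Ioc 0 s)) :=
  (memLp_tsum_sub hs hφ hφp s).mono_measure
    (Measure.restrict_mono (fun _ ht => abs_le.1 (abs_le_of_mem_Ioc ht)) le_rfl)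

theorem integrable_of_integrableOn_Icc (hφ : ∀ t, R < |t| → φ t = 0)
    (h : IntegrableOn φ (Set.Icc (-R) R)) : Integrable φ :=
  (integrableOn_iff_integrable_of_support_subset fun t ht =>
    abs_le.1 (not_lt.1 fun hR => ht (hφ t hR))).1 h

theorem integrable_mul_chr (hφ : ∀ t, R < |t| → φ t = 0) (h2 : MemLp φ 2) (m : ℤ) :
    Integrable fun t => φ t * chr s m t := by
  have hint : Integrable φ := integrable_of_integrableOn_Icc hφ <|
    memLp_one_iff_integrable.1 ((h2.restrict _).mono_exponent one_le_two)
  exact hint.mul_bdd (continuous_chr s m).aestronglyMeasurable (c := 1)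
    (ae_of_all _ fun t => (norm_chr s m t).le)

theorem integrable_conj_mul_tsum_sub (hs : 0 < s) (hφ : ∀ t, R < |t| → φ t = 0)
    (h2 : MemLp φ 2) (hψ : ∀ t, R < |t| → ψ t = 0) (h2' : MemLp ψ 2) :
    Integrable fun t => conj (ψ t) * ∑' k : ℤ, φ (t - k * s) :=
  integrable_of_integrableOn_Icc (R := R) (fun t ht => by simp [hψ t ht]) <|
    (h2'.restrict _).star.integrable_mul (q := 2) (memLp_tsum_sub hs hφ h2 R)

theorem hasSum_integral_chr_mul_conj (hs : 0 < s) (hφ : ∀ t, R < |t| → φ t = 0) (h2 : MemLp φ 2)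
    (hψ : ∀ t, R < |t| → ψ t = 0) (h2' : MemLp ψ 2) :
    HasSum (fun m : ℤ => (∫ t, φ t * chr s m t) * conj (∫ t, ψ t * chr s m t))
      (s * ∫ t, (∑' k : ℤ, φ (t - k * s)) * conj (ψ t)) := by
  have hs' : (s : ℂ) ≠ 0 := by exact_mod_cast hs.ne'
  have hcoeff {φ : ℝ → ℂ} (hφ : ∀ t, R < |t| → φ t = 0) (h2 : MemLp φ 2) (m : ℤ) :
      ∫ t in Set.Ioc 0 s, (∑' k : ℤ, φ (t - k * s)) * chr s m t = ∫ t, φ t * chr s m t :=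
    setIntegral_tsum_sub_mul hs (fun k t => chr_sub hs.ne' m k t) (integrable_mul_chr hφ h2 m)
  have hpairing : ∫ t in Set.Ioc 0 s, (∑' k : ℤ, φ (t - k * s)) * conj (∑' k : ℤ, ψ (t - k * s))
      = ∫ t, (∑' k : ℤ, φ (t - k * s)) * conj (ψ t) := by
    simpa only [Complex.conj_tsum, mul_comm] using
      setIntegral_tsum_sub_mul hs (fun j t => tsum_sub_periodic s φ j t)
        (integrable_conj_mul_tsum_sub hs hφ h2 hψ h2')
  have hparseval := hasSum_fourierCoeffOn_mul_conj hs (memLp_tsum_sub_Ioc hs hφ h2)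
    (memLp_tsum_sub_Ioc hs hψ h2')
  simp only [fourierCoeffOn_eq_chr, hcoeff hφ h2, hcoeff hψ h2', sub_zero, map_mul, map_inv₀,
    Complex.conj_ofReal, intervalIntegral.integral_of_le hs.le, hpairing,
    Complex.real_smul, Complex.ofReal_inv] at hparseval
  convert! hparseval.mul_left ((s : ℂ) ^ 2) using 1
  · ext m
    field_simp
  · rw [← mul_assoc, pow_two, mul_assoc (s : ℂ), mul_inv_cancel₀ hs', mul_one]

end Poisson

/-! ### Walnut's representation -/

theorem lintegral_enorm_sq_lt_top {α E : Type*} [MeasurableSpace α] {μ : Measure α}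
    [NormedAddCommGroup E] {f : α → E} (hf : MemLp f 2 μ) : ∫⁻ t, ‖f t‖ₑ ^ 2 ∂μ < ∞ := by
  simpa using lintegral_rpow_enorm_lt_top_of_eLpNorm_lt_top two_ne_zero ENNReal.ofNat_ne_top hf.2

theorem ennreal_mul_le_sq_add_sq (x y : ℝ≥0∞) : x * y ≤ x ^ 2 + y ^ 2 := by
  rcases le_total x y with h | h
  · calc x * y ≤ y ^ 2 := by rw [sq]; gcongr
      _ ≤ x ^ 2 + y ^ 2 := le_add_self
  · calc x * y ≤ x ^ 2 := by rw [sq]; gcongr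
      _ ≤ x ^ 2 + y ^ 2 := le_self_add

theorem summable_mul_conj_of_sq {ι : Type*} {x y : ι → ℂ} (hx : ∑' n, ‖x n‖ₑ ^ 2 < ∞)
    (hy : ∑' n, ‖y n‖ₑ ^ 2 < ∞) : Summable fun n => x n * conj (y n) := by
  refine Summable.of_norm (tsum_enorm_ne_top_iff_summable_norm.1 (ne_of_lt ?_))
  calc ∑' n, ‖x n * conj (y n)‖ₑ ≤ ∑' n, (‖x n‖ₑ ^ 2 + ‖y n‖ₑ ^ 2) := by
        gcongr with n
        rw [enorm_mul, RCLike.enorm_conj]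
        exact ennreal_mul_le_sq_add_sq _ _
    _ < ∞ := by
        rw [ENNReal.tsum_add]
        exact ENNReal.add_lt_top.2 ⟨hx, hy⟩

/-- A measurable function bounded by `M` and supported in `[-R, R]`. These functions are dense in
every `L^p`, `p < ∞`, and for them the sums in Walnut's representation are finite. -/
structure BddSupp (f : ℝ → ℂ) (M : ℝ≥0) (R : ℝ) : Prop where
  meas : Measurable f
  bdd : ∀ t, ‖f t‖ₑ ≤ M
  supp : ∀ t, R < |t| → f t = 0

theorem BddSupp.memLp {f : ℝ → ℂ} {M : ℝ≥0} {R : ℝ} (hf : BddSupp f M R) (p : ℝ≥0∞) :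
    MemLp f p := by
  have hrestrict : MemLp f p (volume.restrict (Set.Icc (-R) R)) :=
    MemLp.of_bound hf.meas.aestronglyMeasurable M
      (ae_of_all _ fun t => enorm_le_coe.1 (hf.bdd t))
  rw [← memLp_indicator_iff_restrict measurableSet_Icc] at hrestrict
  refine hrestrict.ae_eq (ae_of_all _ fun t => Set.indicator_apply_eq_self.2 fun ht => ?_)
  exact hf.supp t (not_le.1 fun hle => ht (abs_le.1 hle))

section Walnut

variable {a b : ℝ} {g : ℝ → ℂ}

theorem ae_summable_autoCorr (ha : 0 < a) (hg : MemLp g 2) (b : ℝ) :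
    ∀ᵐ t : ℝ, ∀ k : ℤ, Summable fun n : ℤ => g (t - n * a) * conj (g (t - n * a - k / b)) := by
  have hfin : ∀ᵐ t : ℝ, ∑' n : ℤ, ‖g (t - n * a)‖ₑ ^ 2 < ∞ :=
    ae_tsum_sub_lt_top ha (hg.1.enorm.pow_const 2) (lintegral_enorm_sq_lt_top hg).ne
  filter_upwards [hfin, ae_forall_sub hfin b⁻¹] with t h1 h2 k
  refine summable_mul_conj_of_sq h1 ?_
  simpa only [← div_eq_mul_inv, sub_right_comm t] using h2 k

theorem measurable_autoCorr (hgm : Measurable g) (k : ℤ) : Measurable (autoCorr a b g k) := by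
  refine Measurable.tsum fun n => ?_
  have h1 : Measurable fun t : ℝ => g (t - n * a) := hgm.comp (measurable_sub_const _)
  have h2 : Measurable fun t : ℝ => g (t - n * a - k / b) :=
    hgm.comp ((measurable_sub_const _).sub_const _)
  exact h1.mul (Complex.continuous_conj.measurable.comp h2)

theorem conj_whFun (m n : ℤ) (t : ℝ) :
    conj (whFun a b g m n t) = chr b⁻¹ m t * conj (g (t - n * a)) := by
  rw [whFun, map_mul, ← Complex.exp_conj, chr]
  congr 2
  simp only [map_mul, Complex.conj_ofReal, Complex.conj_I, map_ofNat]
  push_cast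
  field_simp

theorem integral_mul_conj_whFun (f : ℝ → ℂ) (m n : ℤ) :
    ∫ t, f t * conj (whFun a b g m n t)
      = ∫ t, f t * conj (g (t - n * a)) * chr b⁻¹ m t := by
  simp only [conj_whFun, mul_assoc, mul_comm (chr _ _ _)]

/-- The function of `t` whose integral is the contribution of the translate `T_{na} g` to
`∑_{m,n} ⟨f, E_{mb} T_{na} g⟩ ⟨E_{mb} T_{na} g, h⟩`, up to the factor `b⁻¹`. -/
noncomputable def walnutTerm (a b : ℝ) (g f h : ℝ → ℂ) (n : ℤ) (t : ℝ) : ℂ :=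
  (∑' k : ℤ, f (t - k * b⁻¹) * conj (g (t - k * b⁻¹ - n * a))) * conj (h t * conj (g (t - n * a)))

variable {f h : ℝ → ℂ} {M : ℝ≥0} {R : ℝ}

theorem BddSupp.memLp_mul_conj (hf : BddSupp f M R) (hg : MemLp g 2) (c : ℝ) :
    MemLp (fun t => f t * conj (g (t - c))) 2 :=
  (hg.comp_measurePreserving (measurePreserving_sub_right volume c)).star.mul (r := 2) (hf.memLp ∞)

theorem walnutTerm_eq_sum (hb : 0 < b) (hf : BddSupp f M R) {t : ℝ} (ht : |t| ≤ R) (n : ℤ) :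
    walnutTerm a b g f h n t = ∑ k ∈ meetSet b⁻¹ (R + R),
      f (t - k * b⁻¹) * conj (h t) * (g (t - n * a) * conj (g (t - n * a - k / b))) := by
  rw [walnutTerm, tsum_eq_sum (s := meetSet b⁻¹ (R + R)) fun k hk => ?_, Finset.sum_mul]
  · refine Finset.sum_congr rfl fun k _ => ?_
    rw [map_mul, Complex.conj_conj, div_eq_mul_inv, sub_right_comm t]
    ring
  · rw [hf.supp _ (lt_abs_sub_of_notMem_meetSet (inv_pos.2 hb) ht hk), zero_mul]

theorem walnutTerm_eq_zero (hh : BddSupp h M R) {t : ℝ} (ht : R < |t|) (n : ℤ) :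
    walnutTerm a b g f h n t = 0 := by
  rw [walnutTerm, hh.supp t ht, zero_mul, map_zero, mul_zero]

theorem measurable_walnutTerm (hf : Measurable f) (hh : Measurable h) (hgm : Measurable g)
    (n : ℤ) : Measurable (walnutTerm a b g f h n) := by
  have hconj : Measurable fun t : ℝ => conj (g (t - n * a)) :=
    Complex.continuous_conj.measurable.comp (hgm.comp (measurable_sub_const _))
  exact (Measurable.tsum fun k => (hf.mul hconj).comp (measurable_sub_const _)).mul
    (Complex.continuous_conj.measurable.comp (hh.mul hconj))

theorem enorm_walnutTerm_le (hb : 0 < b) (hf : BddSupp f M R) (hh : BddSupp h M R) {t : ℝ}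
    (ht : |t| ≤ R) (n : ℤ) :
    ‖walnutTerm a b g f h n t‖ₑ ≤ ∑ k ∈ meetSet b⁻¹ (R + R),
      (M * M : ℝ≥0∞) * (‖g (t - n * a)‖ₑ ^ 2 + ‖g (t - n * a - k / b)‖ₑ ^ 2) := by
  rw [walnutTerm_eq_sum hb hf ht]
  refine (enorm_sum_le _ _).trans (Finset.sum_le_sum fun k _ => ?_)
  simp only [enorm_mul, RCLike.enorm_conj]
  exact mul_le_mul' (mul_le_mul' (hf.bdd _) (hh.bdd _)) (ennreal_mul_le_sq_add_sq _ _)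

theorem setLIntegral_Icc_tsum_enorm_sq_lt_top (ha : 0 < a) (hg : MemLp g 2) (c : ℝ) :
    ∫⁻ t in Set.Icc (-R) R, ∑' n : ℤ, ‖g (t - n * a - c)‖ₑ ^ 2 < ∞ := by
  refine (setLIntegral_Icc_tsum_sub_le ha
    ((aemeasurable_comp_sub hg.1.aemeasurable c).enorm.pow_const 2)).trans_lt
      (ENNReal.mul_lt_top (ENNReal.natCast_lt_top _) ?_)
  rw [lintegral_sub_right_eq_self (fun t => ‖g t‖ₑ ^ 2)]
  exact lintegral_enorm_sq_lt_top hg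

theorem tsum_lintegral_walnutTerm_lt_top (ha : 0 < a) (hb : 0 < b) (hg : MemLp g 2)
    (hgm : Measurable g) (hf : BddSupp f M R) (hh : BddSupp h M R) :
    ∑' n : ℤ, ∫⁻ t, ‖walnutTerm a b g f h n t‖ₑ < ∞ := by
  have hm (c : ℝ) : Measurable fun t => ∑' n : ℤ, ‖g (t - n * a - c)‖ₑ ^ 2 :=
    Measurable.tsum fun n => (hgm.enorm.pow_const 2).comp ((measurable_sub_const _).sub_const _)
  have hm2 (k : ℤ) : Measurable fun t => ∑' n : ℤ, ‖g (t - n * a - 0)‖ₑ ^ 2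
      + ∑' n : ℤ, ‖g (t - n * a - k / b)‖ₑ ^ 2 := (hm 0).add (hm (k / b))
  have hle (t : ℝ) : ∑' n : ℤ, ‖walnutTerm a b g f h n t‖ₑ ≤ (Set.Icc (-R) R).indicator (fun t =>
      ∑ k ∈ meetSet b⁻¹ (R + R), (M * M : ℝ≥0∞) * (∑' n : ℤ, ‖g (t - n * a - 0)‖ₑ ^ 2
        + ∑' n : ℤ, ‖g (t - n * a - k / b)‖ₑ ^ 2)) t := by
    by_cases ht : |t| ≤ R
    · rw [Set.indicator_of_mem (Set.mem_Icc.2 (abs_le.1 ht))]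
      simp only [sub_zero, ← ENNReal.tsum_add, ← ENNReal.tsum_mul_left]
      rw [← Summable.tsum_finsetSum fun _ _ => ENNReal.summable]
      exact ENNReal.tsum_le_tsum fun n => enorm_walnutTerm_le hb hf hh ht n
    · simp [walnutTerm_eq_zero hh (not_le.1 ht)]
  rw [← lintegral_tsum fun n => (measurable_walnutTerm hf.meas hh.meas hgm n).enorm.aemeasurable]
  refine (lintegral_mono hle).trans_lt ?_
  rw [lintegral_indicator measurableSet_Icc,
    lintegral_finsetSum _ fun k _ => (hm2 k).const_mul _]
  refine ENNReal.sum_lt_top.2 fun k _ => ?_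
  rw [lintegral_const_mul _ (hm2 k), lintegral_add_left (hm 0)]
  exact ENNReal.mul_lt_top (ENNReal.mul_lt_top ENNReal.coe_lt_top ENNReal.coe_lt_top)
    (ENNReal.add_lt_top.2 ⟨setLIntegral_Icc_tsum_enorm_sq_lt_top ha hg 0,
      setLIntegral_Icc_tsum_enorm_sq_lt_top ha hg _⟩)

theorem tsum_walnutTerm_ae (ha : 0 < a) (hb : 0 < b) (hg : MemLp g 2) (hf : BddSupp f M R)
    (hh : BddSupp h M R) :
    ∀ᵐ t : ℝ, ∑' n : ℤ, walnutTerm a b g f h n t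
      = kerSum b⁻¹ (autoCorr a b g) f t * conj (h t) := by
  filter_upwards [ae_summable_autoCorr ha hg b] with t hs
  by_cases ht : |t| ≤ R
  · have hzero : ∀ k ∉ meetSet b⁻¹ (R + R), autoCorr a b g k t * f (t - k * b⁻¹) = 0 :=
      fun k hk => by
        rw [hf.supp _ (lt_abs_sub_of_notMem_meetSet (inv_pos.2 hb) ht hk), mul_zero]
    simp only [walnutTerm_eq_sum hb hf ht]
    rw [Summable.tsum_finsetSum fun k _ => (hs k).mul_left _, kerSum, tsum_eq_sum hzero,
      Finset.sum_mul]
    refine Finset.sum_congr rfl fun k _ => ?_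
    rw [tsum_mul_left, autoCorr]
    ring
  · simp [walnutTerm_eq_zero hh (not_le.1 ht), hh.supp t (not_le.1 ht)]

theorem hasSum_integral_walnutTerm (ha : 0 < a) (hb : 0 < b) (hg : MemLp g 2) (hgm : Measurable g)
    (hf : BddSupp f M R) (hh : BddSupp h M R) :
    HasSum (fun n : ℤ => ∫ t, walnutTerm a b g f h n t)
      (∫ t, kerSum b⁻¹ (autoCorr a b g) f t * conj (h t)) := by
  have hfin := tsum_lintegral_walnutTerm_lt_top ha hb hg hgm hf hh
  have hm (n : ℤ) : AEStronglyMeasurable (walnutTerm a b g f h n) :=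
    (measurable_walnutTerm hf.meas hh.meas hgm n).aestronglyMeasurable
  rw [← integral_congr_ae (tsum_walnutTerm_ae ha hb hg hf hh)]
  refine hasSum_integral_of_summable_integral_norm
    (fun n => ⟨hm n, (ENNReal.le_tsum n).trans_lt hfin⟩) ?_
  simp only [integral_norm_eq_lintegral_enorm (hm _)]
  exact ENNReal.summable_toReal hfin.ne

theorem hasSum_integral_mul_conj_whFun (hb : 0 < b) (hg : MemLp g 2) (hf : BddSupp f M R)
    (hh : BddSupp h M R) (n : ℤ) :
    HasSum (fun m : ℤ => (∫ t, f t * conj (whFun a b g m n t))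
        * conj (∫ t, h t * conj (whFun a b g m n t)))
      ((b : ℂ)⁻¹ * ∫ t, walnutTerm a b g f h n t) := by
  simp only [integral_mul_conj_whFun]
  rw [← Complex.ofReal_inv]
  exact hasSum_integral_chr_mul_conj (inv_pos.2 hb) (R := R)
    (fun t ht => by rw [hf.supp t ht, zero_mul]) (hf.memLp_mul_conj hg _)
    (fun t ht => by rw [hh.supp t ht, zero_mul]) (hh.memLp_mul_conj hg _)

theorem summable_norm_sq_integral_mul_conj_whFun (ha : 0 < a) (hb : 0 < b) (hg : MemLp g 2)
    (hgm : Measurable g) (hf : BddSupp f M R) :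
    Summable fun i : ℤ × ℤ => ‖∫ t, f t * conj (whFun a b g i.2 i.1 t)‖ ^ 2 := by
  have hfib (n : ℤ) : HasSum (fun m : ℤ => ‖∫ t, f t * conj (whFun a b g m n t)‖ ^ 2)
      ((b : ℂ)⁻¹ * ∫ t, walnutTerm a b g f f n t).re := by
    simpa only [Complex.mul_conj, Complex.normSq_eq_norm_sq, Complex.ofReal_re] using
      Complex.hasSum_re (hasSum_integral_mul_conj_whFun hb hg hf hf n)
  rw [summable_prod_of_nonneg fun _ => by positivity]
  refine ⟨fun n => (hfib n).summable, ?_⟩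
  simp only [(hfib _).tsum_eq]
  exact (Complex.hasSum_re
    ((hasSum_integral_walnutTerm ha hb hg hgm hf hf).mul_left _)).summable

theorem summable_mul_conj_of_norm_sq {ι : Type*} {x y : ι → ℂ} (hx : Summable fun i => ‖x i‖ ^ 2)
    (hy : Summable fun i => ‖y i‖ ^ 2) : Summable fun i => x i * conj (y i) := by
  refine Summable.of_norm_bounded (hx.add hy) fun i => ?_
  rw [norm_mul, RCLike.norm_conj]
  nlinarith [sq_nonneg (‖x i‖ - ‖y i‖), sq_nonneg ‖x i‖, sq_nonneg ‖y i‖]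

theorem hasSum_whFun_coeff (ha : 0 < a) (hb : 0 < b) (hg : MemLp g 2) (hgm : Measurable g)
    (hf : BddSupp f M R) (hh : BddSupp h M R) :
    HasSum (fun i : ℤ × ℤ => (∫ t, f t * conj (whFun a b g i.1 i.2 t))
        * conj (∫ t, h t * conj (whFun a b g i.1 i.2 t)))
      ((b : ℂ)⁻¹ * ∫ t, kerSum b⁻¹ (autoCorr a b g) f t * conj (h t)) := by
  have hsum := summable_mul_conj_of_norm_sq
    (summable_norm_sq_integral_mul_conj_whFun (b := b) ha hb hg hgm hf)
    (summable_norm_sq_integral_mul_conj_whFun (b := b) ha hb hg hgm hh)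
  have hiter := hsum.hasSum.prod_fiberwise fun n => hasSum_integral_mul_conj_whFun hb hg hf hh n
  rw [← (Equiv.prodComm ℤ ℤ).hasSum_iff,
    ← hiter.unique ((hasSum_integral_walnutTerm ha hb hg hgm hf hh).mul_left _)]
  exact hsum.hasSum

end Walnut

/-! ### The frame operator -/

section Bessel

variable {ι H : Type*} [NormedAddCommGroup H] [InnerProductSpace ℂ H] {v : ι → H} {B : ℝ≥0}

/-- `v` is a Bessel sequence with bound `B`; the bound is imposed on finite subfamilies, so that it
contains the summability. -/
def IsBessel (v : ι → H) (B : ℝ≥0) : Prop :=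
  ∀ (f : H) (F : Finset ι), ∑ i ∈ F, ‖inner ℂ (v i) f‖ ^ 2 ≤ B * ‖f‖ ^ 2

theorem IsBessel.norm_sum_smul_sq_le (hB : IsBessel v B) (c : ι → ℂ) (F : Finset ι) :
    ‖∑ i ∈ F, c i • v i‖ ^ 2 ≤ B * ∑ i ∈ F, ‖c i‖ ^ 2 := by
  set y := ∑ i ∈ F, c i • v i with hy
  have hyy : ‖y‖ ^ 2 ≤ ∑ i ∈ F, ‖c i‖ * ‖inner ℂ (v i) y‖ :=
    calc ‖y‖ ^ 2 = ‖(inner ℂ y y : ℂ)‖ := by simp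
      _ = ‖∑ i ∈ F, conj (c i) * inner ℂ (v i) y‖ := by
          conv_lhs => rw [hy, sum_inner, ← hy]
          simp only [inner_smul_left]
      _ ≤ ∑ i ∈ F, ‖c i‖ * ‖inner ℂ (v i) y‖ := by
          simpa only [norm_mul, RCLike.norm_conj] using
            norm_sum_le F fun i => conj (c i) * inner ℂ (v i) y
  have hcs : (‖y‖ ^ 2) ^ 2 ≤ (∑ i ∈ F, ‖c i‖ ^ 2) * (B * ‖y‖ ^ 2) :=
    calc (‖y‖ ^ 2) ^ 2 ≤ (∑ i ∈ F, ‖c i‖ * ‖inner ℂ (v i) y‖) ^ 2 := by gcongr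
      _ ≤ _ := Finset.sum_mul_sq_le_sq_mul_sq F _ _
      _ ≤ _ := by gcongr; exact hB y F
  rcases (sq_nonneg ‖y‖).eq_or_lt with h0 | h0
  · rw [← h0]
    positivity
  · exact le_of_mul_le_mul_right (by linarith) h0

theorem IsBessel.summable [CompleteSpace H] (hB : IsBessel v B) (f : H) :
    Summable fun i => (inner ℂ (v i) f : ℂ) • v i := by
  have hs : Summable fun i => ‖inner ℂ (v i) f‖ ^ 2 :=
    summable_of_sum_le (fun _ => by positivity) (hB f)
  rw [summable_iff_vanishing_norm] at hs ⊢
  intro ε hε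
  obtain ⟨s, hs⟩ := hs (ε ^ 2 / (B + 1)) (by positivity)
  refine ⟨s, fun t ht => lt_of_pow_lt_pow_left₀ 2 hε.le ?_⟩
  have hsmall := hs t ht
  have hnonneg : 0 ≤ ∑ i ∈ t, ‖inner ℂ (v i) f‖ ^ 2 := Finset.sum_nonneg fun _ _ => sq_nonneg _
  rw [Real.norm_of_nonneg hnonneg, lt_div_iff₀ (by positivity)] at hsmall
  linarith [hB.norm_sum_smul_sq_le (fun i => inner ℂ (v i) f) t]

/-- The frame operator of a Bessel sequence. -/
noncomputable def IsBessel.frameOp [CompleteSpace H] (hB : IsBessel v B) : H →L[ℂ] H :=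
  LinearMap.mkContinuous
    { toFun := fun f => ∑' i, (inner ℂ (v i) f : ℂ) • v i
      map_add' := fun f h => by
        simp only [inner_add_right, add_smul]
        exact (hB.summable f).tsum_add (hB.summable h)
      map_smul' := fun c f => by
        simp only [inner_smul_right, mul_smul]
        exact (hB.summable f).tsum_const_smul c }
    B fun f => by
      refine le_of_tendsto (hB.summable f).hasSum.norm (Eventually.of_forall fun F => ?_)
      refine le_of_sq_le_sq ?_ (by positivity)
      calc ‖∑ i ∈ F, inner ℂ (v i) f • v i‖ ^ 2
          ≤ B * ∑ i ∈ F, ‖inner ℂ (v i) f‖ ^ 2 := hB.norm_sum_smul_sq_le _ F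
        _ ≤ B * (B * ‖f‖ ^ 2) := by gcongr; exact hB f F
        _ = (B * ‖f‖) ^ 2 := by ring

theorem IsBessel.hasSum_frameOp [CompleteSpace H] (hB : IsBessel v B) (f : H) :
    HasSum (fun i => (inner ℂ (v i) f : ℂ) • v i) (hB.frameOp f) :=
  (hB.summable f).hasSum

theorem inner_mul_inner_re (x y : H) : (inner ℂ x y * inner ℂ y x : ℂ).re = ‖inner ℂ x y‖ ^ 2 := by
  rw [← inner_conj_symm y, Complex.mul_conj, Complex.normSq_eq_norm_sq, Complex.ofReal_re]

theorem isBessel_of_dense {T : H →L[ℂ] H} {D : Set H} (hD : Dense D)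
    (h : ∀ u ∈ D, HasSum (fun i => inner ℂ (v i) u * inner ℂ u (v i)) (inner ℂ u (T u))) :
    IsBessel v ‖T‖₊ := by
  intro f F
  refine hD.induction (P := fun f => ∑ i ∈ F, ‖inner ℂ (v i) f‖ ^ 2 ≤ ‖T‖₊ * ‖f‖ ^ 2)
    (fun u hu => ?_) (isClosed_le (by fun_prop) (by fun_prop)) f
  have hsq : HasSum (fun i => ‖inner ℂ (v i) u‖ ^ 2) (inner ℂ u (T u)).re := by
    simpa only [inner_mul_inner_re] using Complex.hasSum_re (h u hu)
  calc ∑ i ∈ F, ‖inner ℂ (v i) u‖ ^ 2 ≤ (inner ℂ u (T u)).re :=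
        sum_le_hasSum F (fun _ _ => by positivity) hsq
    _ ≤ ‖u‖ * ‖T u‖ := (Complex.re_le_norm _).trans (norm_inner_le_norm _ _)
    _ ≤ ‖u‖ * (‖T‖ * ‖u‖) := by gcongr; exact T.le_opNorm u
    _ = ‖T‖₊ * ‖u‖ ^ 2 := by rw [coe_nnnorm]; ring

theorem hasSum_inner_smul_of_dense [CompleteSpace H] {T : H →L[ℂ] H} {D : Set H} (hD : Dense D)
    (h : ∀ u ∈ D, ∀ w ∈ D,
      HasSum (fun i => inner ℂ (v i) u * inner ℂ w (v i)) (inner ℂ w (T u))) (u : H) :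
    HasSum (fun i => (inner ℂ (v i) u : ℂ) • v i) (T u) := by
  have hB : IsBessel v ‖T‖₊ := isBessel_of_dense hD fun u hu => h u hu u hu
  suffices hB.frameOp = T from this ▸ hB.hasSum_frameOp u
  refine ContinuousLinearMap.coeFn_injective
    (hB.frameOp.continuous.ext_on hD T.continuous fun u hu => ?_)
  refine hD.eq_of_inner_right (𝕜 := ℂ) fun w hw => ?_
  refine HasSum.unique ?_ (h u hu w hw)
  simpa only [innerSL_apply_apply, inner_smul_right] using
    (hB.hasSum_frameOp u).mapL (innerSL ℂ w)

end Bessel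

section FrameOperator

variable {a b : ℝ} {C : ℝ≥0}

/-- The Hilbert space `L²(ℝ)`. -/
abbrev LTwo : Type := Lp ℂ 2 (volume : Measure ℝ)

variable {g : LTwo}

theorem measurable_coeFn {p : ℝ≥0∞} (f : Lp ℂ p (volume : Measure ℝ)) : Measurable (f : ℝ → ℂ) :=
  (Lp.stronglyMeasurable f).measurable

theorem inner_eq_integral (u w : LTwo) : inner ℂ u w = ∫ t, w t * conj (u t) := by
  simp only [L2.inner_def, RCLike.inner_apply]

theorem inner_whSystem {u : LTwo} {f : ℝ → ℂ} (huf : u =ᵐ[volume] f) (i : ℤ × ℤ) :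
    inner ℂ (whSystem a b g i) u = ∫ t, f t * conj (whFun a b g i.1 i.2 t) := by
  rw [inner_eq_integral]
  refine integral_congr_ae ?_
  filter_upwards [huf, MemLp.coeFn_toLp (memLp_whFun a b (Lp.memLp g) i.1 i.2)] with t hu hwh
  rw [hu, whSystem, hwh]

/-- The classes in `L^p` of the bounded functions with bounded support. -/
def bddSuppClasses (p : ℝ≥0∞) : Set (Lp ℂ p (volume : Measure ℝ)) :=
  {u | ∃ f M R, BddSupp f M R ∧ u =ᵐ[volume] f}

theorem exists_bddSupp_of_hasCompactSupport {f : ℝ → ℂ} (hf : Continuous f)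
    (hsupp : HasCompactSupport f) : ∃ M R, BddSupp f M R := by
  obtain ⟨M, hM⟩ := hf.norm.bddAbove_range_of_hasCompactSupport hsupp.norm
  obtain ⟨R, hR⟩ := hsupp.isCompact.isBounded.subset_closedBall 0
  refine ⟨M.toNNReal, R, hf.measurable, fun t => ?_, fun t ht => ?_⟩
  · rw [← ofReal_norm]
    exact ENNReal.ofReal_le_ofReal (hM ⟨t, rfl⟩)
  · by_contra hne
    have hle := hR (subset_tsupport f hne)
    rw [mem_closedBall_zero_iff, Real.norm_eq_abs] at hle
    exact ht.not_ge hle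

theorem dense_bddSuppClasses {p : ℝ≥0∞} [Fact (1 ≤ p)] (hp : p ≠ ∞) :
    Dense (bddSuppClasses p) := by
  intro u
  refine EMetric.mem_closure_iff.2 fun ε hε => ?_
  obtain ⟨δ, hδ, hδε⟩ := exists_between hε
  obtain ⟨f, hsupp, hle, hcont, hmem⟩ :=
    (Lp.memLp u).exists_hasCompactSupport_eLpNorm_sub_le hp hδ.ne'
  obtain ⟨M, R, hf⟩ := exists_bddSupp_of_hasCompactSupport hcont hsupp
  refine ⟨hmem.toLp, ⟨f, M, R, hf, hmem.coeFn_toLp⟩, ?_⟩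
  rw [Lp.edist_def, eLpNorm_congr_ae (EventuallyEq.rfl.sub hmem.coeFn_toLp)]
  exact hle.trans_lt hδε

theorem BddSupp.mono {f : ℝ → ℂ} {M M' : ℝ≥0} {R R' : ℝ} (hf : BddSupp f M R) (hM : M ≤ M')
    (hR : R ≤ R') : BddSupp f M' R' where
  meas := hf.meas
  bdd t := (hf.bdd t).trans (by exact_mod_cast hM)
  supp t ht := hf.supp t (hR.trans_lt ht)

variable {u w : LTwo} {f h : ℝ → ℂ} {M M' : ℝ≥0} {R R' : ℝ}

theorem hasSum_inner_whSystem (ha : 0 < a) (hb : 0 < b) (hf : BddSupp f M R)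
    (hh : BddSupp h M' R') (hu : u =ᵐ[volume] f) (hw : w =ᵐ[volume] h) :
    HasSum (fun i => inner ℂ (whSystem a b g i) u * inner ℂ w (whSystem a b g i))
      ((b : ℂ)⁻¹ * ∫ t, kerSum b⁻¹ (autoCorr a b g) f t * conj (h t)) := by
  simp only [← inner_conj_symm w, inner_whSystem hu, inner_whSystem hw]
  exact hasSum_whFun_coeff ha hb (Lp.memLp g) (measurable_coeFn g)
    (hf.mono (le_max_left M M') (le_max_left R R'))
    (hh.mono (le_max_right M M') (le_max_right R R'))

theorem IsFrameOpValue.inner_eq (ha : 0 < a) (hb : 0 < b) {v : LTwo}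
    (hv : IsFrameOpValue a b g u v) (hf : BddSupp f M R) (hh : BddSupp h M' R')
    (hu : u =ᵐ[volume] f) (hw : w =ᵐ[volume] h) :
    inner ℂ w v = (b : ℂ)⁻¹ * ∫ t, kerSum b⁻¹ (autoCorr a b g) f t * conj (h t) := by
  refine HasSum.unique ?_ (hasSum_inner_whSystem ha hb hf hh hu hw)
  simpa only [innerSL_apply_apply, inner_smul_right] using hv.mapL (innerSL ℂ w)

theorem autoCorr_neg (g : ℝ → ℂ) (k : ℤ) (t : ℝ) :
    autoCorr a b g (-k) t = conj (autoCorr a b g k (t + k / b)) := by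
  simp only [autoCorr, Complex.conj_tsum, map_mul, Complex.conj_conj]
  refine tsum_congr fun n => ?_
  rw [mul_comm]
  congr 2
  · push_cast; ring_nf
  · ring_nf

theorem isSchurKernel_autoCorr {g : ℝ → ℂ} (hgm : Measurable g)
    (hC : ∀ᵐ t : ℝ, ∑' k : ℤ, ‖autoCorr a b g k t‖ₑ ≤ C) :
    IsSchurKernel b⁻¹ (autoCorr a b g) C := by
  refine ⟨measurable_autoCorr hgm, hC, hC.mono fun t ht => le_of_eq_of_le ?_ ht⟩
  rw [← (Equiv.neg ℤ).tsum_eq]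
  refine tsum_congr fun k => ?_
  rw [Equiv.neg_apply, autoCorr_neg, RCLike.enorm_conj]
  congr 2
  push_cast
  ring

theorem IsSchurKernel.inner_toCLM (hG : IsSchurKernel b⁻¹ (autoCorr a b g) C)
    (hu : u =ᵐ[volume] f) (hw : w =ᵐ[volume] h) :
    inner ℂ w (hG.toCLM 2 u) = ∫ t, kerSum b⁻¹ (autoCorr a b g) f t * conj (h t) := by
  rw [inner_eq_integral]
  refine integral_congr_ae ?_
  filter_upwards [(hG.toCLM_ae u).trans (kerSum_congr_ae hu), hw] with t hTu hwt
  rw [hTu, hwt]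

theorem IsSchurKernel.isFrameOpValue (ha : 0 < a) (hb : 0 < b)
    (hG : IsSchurKernel b⁻¹ (autoCorr a b g) C) (u : LTwo) :
    IsFrameOpValue a b g u ((b : ℂ)⁻¹ • hG.toCLM 2 u) := by
  refine hasSum_inner_smul_of_dense (T := (b : ℂ)⁻¹ • hG.toCLM 2)
    (dense_bddSuppClasses ENNReal.ofNat_ne_top) ?_ u
  rintro u ⟨f, M, R, hf, hu⟩ w ⟨h, M', R', hh, hw⟩
  rw [smul_apply, inner_smul_right, hG.inner_toCLM hu hw]
  exact hasSum_inner_whSystem ha hb hf hh hu hw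

theorem IsSchurKernel.extendsFrameOp (ha : 0 < a) (hb : 0 < b)
    (hG : IsSchurKernel b⁻¹ (autoCorr a b g) C) {p : ℝ≥0∞} [Fact (1 ≤ p)]
    {X : Type*} {incl T : X → Lp ℂ p (volume : Measure ℝ)}
    (hT : ∀ f, T f = (b : ℂ)⁻¹ • hG.toCLM p (incl f)) : ExtendsFrameOp a b g incl T := by
  intro f u hfu
  refine ⟨_, hG.isFrameOpValue ha hb u, ?_⟩
  rw [hT]
  exact ((Lp.coeFn_smul _ _).trans ((hG.toCLM_ae _).const_smul _)).trans
    ((((kerSum_congr_ae hfu).trans (hG.toCLM_ae u).symm).const_smul _).trans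
      (Lp.coeFn_smul _ _).symm)

end FrameOperator

/-! ### Necessity of the CC-condition -/

section Necessity

variable {a b : ℝ} {g u : LTwo} {f h : ℝ → ℂ} {M M' : ℝ≥0} {R R' : ℝ}

theorem exists_bddSupp_indicator_one {K : Set ℝ} (hK : IsCompact K) :
    ∃ R, BddSupp (K.indicator fun _ => 1) 1 R := by
  obtain ⟨R, hR⟩ := hK.isBounded.subset_closedBall 0
  refine ⟨R, measurable_const.indicator hK.measurableSet, fun t => ?_, fun t ht => ?_⟩
  · exact (enorm_indicator_le_enorm_self _ _).trans (by simp)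
  · refine Set.indicator_of_notMem (fun htK => ht.not_ge ?_) _
    simpa using hR htK

theorem integrable_kerSum_mul_conj (ha : 0 < a) (hb : 0 < b) {g : ℝ → ℂ} (hg : MemLp g 2)
    (hgm : Measurable g) (hf : BddSupp f M R) (hh : BddSupp h M' R') :
    Integrable fun t => kerSum b⁻¹ (autoCorr a b g) f t * conj (h t) := by
  replace hf := hf.mono (le_max_left M M') (le_max_left R R')
  replace hh := hh.mono (le_max_right M M') (le_max_right R R')
  have hm (n : ℤ) := measurable_walnutTerm (a := a) (b := b) hf.meas hh.meas hgm n
  refine Integrable.congr ⟨(Measurable.tsum hm).aestronglyMeasurable, ?_⟩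
    (tsum_walnutTerm_ae ha hb hg hf hh)
  refine (lintegral_mono fun t => enorm_tsum_le_tsum_enorm).trans_lt ?_
  rw [lintegral_tsum fun n => (hm n).enorm.aemeasurable]
  exact tsum_lintegral_walnutTerm_lt_top ha hb hg hgm hf hh

theorem kerSum_mul_conj_indicator_one (Γ : ℤ → ℝ → ℂ) (f : ℝ → ℂ) (K : Set ℝ) (t : ℝ) :
    kerSum b⁻¹ Γ f t * conj (K.indicator (fun _ => 1) t) = K.indicator (kerSum b⁻¹ Γ f) t := by
  by_cases ht : t ∈ K <;> simp [ht]

theorem integrableOn_kerSum_autoCorr (ha : 0 < a) (hb : 0 < b) (hf : BddSupp f M R) {K : Set ℝ}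
    (hK : IsCompact K) : IntegrableOn (kerSum b⁻¹ (autoCorr a b g) f) K := by
  obtain ⟨R', hh⟩ := exists_bddSupp_indicator_one hK
  rw [← integrable_indicator_iff hK.measurableSet]
  simpa only [kerSum_mul_conj_indicator_one] using
    integrable_kerSum_mul_conj ha hb (Lp.memLp g) (measurable_coeFn g) hf hh

theorem IsFrameOpValue.ae_eq (ha : 0 < a) (hb : 0 < b) {v : LTwo} (hv : IsFrameOpValue a b g u v)
    (hf : BddSupp f M R) (hu : u =ᵐ[volume] f) :
    v =ᵐ[volume] fun t => (b : ℂ)⁻¹ * kerSum b⁻¹ (autoCorr a b g) f t := by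
  have hvloc : LocallyIntegrable v := (Lp.memLp v).locallyIntegrable one_le_two
  have hTloc (K : Set ℝ) (hK : IsCompact K) :
      IntegrableOn (fun t => (b : ℂ)⁻¹ * kerSum b⁻¹ (autoCorr a b g) f t) K :=
    (integrableOn_kerSum_autoCorr ha hb hf hK).const_mul _
  rw [← sub_ae_eq_zero]
  refine ae_eq_zero_of_forall_setIntegral_isCompact_eq_zero'
    (hvloc.sub (locallyIntegrable_iff.2 hTloc)) fun K hK => ?_
  obtain ⟨R', hh⟩ := exists_bddSupp_indicator_one hK
  have hinner := hv.inner_eq ha hb hf hh hu (hh.memLp 2).coeFn_toLp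
  have hleft : inner ℂ (hh.memLp 2).toLp v = ∫ t in K, v t := by
    rw [inner_eq_integral, ← integral_indicator hK.measurableSet]
    refine integral_congr_ae ((hh.memLp 2).coeFn_toLp.mono fun t ht => ?_)
    by_cases htK : t ∈ K <;> simp [ht, htK]
  simp only [kerSum_mul_conj_indicator_one, integral_indicator hK.measurableSet] at hinner
  simp only [Pi.sub_apply]
  rw [integral_sub (hvloc.integrableOn_isCompact hK) (hTloc K hK), integral_const_mul, ← hleft,
    hinner, sub_self]

theorem BddSupp.toLp_mem (hf : BddSupp f M R) : (hf.memLp ∞).toLp ∈ LInftyZero := by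
  refine subset_closure ⟨Set.Icc (-R) R, isCompact_Icc, ?_⟩
  filter_upwards [(hf.memLp ∞).coeFn_toLp] with t hft ht
  rw [hft]
  exact hf.supp t (not_le.1 fun hle => ht (abs_le.1 hle))

theorem BddSupp.norm_toLp_le (hf : BddSupp f M R) : ‖(hf.memLp ∞).toLp‖ ≤ M := by
  rw [Lp.norm_toLp, ← ENNReal.coe_toReal, eLpNorm_exponent_top]
  exact ENNReal.toReal_mono ENNReal.coe_ne_top
    (eLpNormEssSup_le_of_ae_enorm_bound (ae_of_all _ hf.bdd))

theorem ae_enorm_kerSum_le (ha : 0 < a) (hb : 0 < b)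
    {T : LInftyZero →L[ℂ] Lp ℂ ∞ (volume : Measure ℝ)} (hT : ExtendsFrameOp a b g Subtype.val T)
    (hf : BddSupp f M R) :
    ∀ᵐ t : ℝ, ‖kerSum b⁻¹ (autoCorr a b g) f t‖ₑ ≤ ENNReal.ofReal (b * (‖T‖ * M)) := by
  obtain ⟨v, hv, hTv⟩ := hT ⟨_, hf.toLp_mem⟩ (hf.memLp 2).toLp
    ((hf.memLp ∞).coeFn_toLp.trans (hf.memLp 2).coeFn_toLp.symm)
  have hnorm : ‖T ⟨_, hf.toLp_mem⟩‖ ≤ ‖T‖ * M :=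
    (T.le_opNorm _).trans (mul_le_mul_of_nonneg_left hf.norm_toLp_le (norm_nonneg T))
  have hb' : (b : ℂ) ≠ 0 := by exact_mod_cast hb.ne'
  filter_upwards [hTv.trans (hv.ae_eq ha hb hf (hf.memLp 2).coeFn_toLp),
    enorm_ae_le_eLpNormEssSup (T ⟨_, hf.toLp_mem⟩) volume] with t hval hle
  rw [← eLpNorm_exponent_top, ← Lp.enorm_def, hval] at hle
  calc ‖kerSum b⁻¹ (autoCorr a b g) f t‖ₑ
      = ‖(b : ℂ)‖ₑ * ‖(b : ℂ)⁻¹ * kerSum b⁻¹ (autoCorr a b g) f t‖ₑ := by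
        rw [← enorm_mul, mul_inv_cancel_left₀ hb']
    _ ≤ ‖(b : ℂ)‖ₑ * ‖T ⟨_, hf.toLp_mem⟩‖ₑ := by gcongr
    _ = ENNReal.ofReal (b * ‖T ⟨_, hf.toLp_mem⟩‖) := by
        rw [ENNReal.ofReal_mul hb.le, ofReal_norm, ← ofReal_norm, Complex.norm_of_nonneg hb.le]
    _ ≤ ENNReal.ofReal (b * (‖T‖ * M)) := by gcongr

theorem ceil_sub_mul_div {s : ℝ} (hs : s ≠ 0) (t : ℝ) (k : ℤ) :
    ⌈(t - k * s) / s⌉ = ⌈t / s⌉ - k := by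
  rw [sub_div, mul_div_cancel_right₀ _ hs, Int.ceil_sub_intCast]

/-- The test function whose value at `t - k s`, for `k ∈ F` and `t` in the `J`-th cell
`((J - 1) s, J s]`, is the unimodular number that turns `Γₖ t` into its absolute value. -/
noncomputable def phaseFun (s : ℝ) (Γ : ℤ → ℝ → ℂ) (F : Finset ℤ) (J : ℤ) (x : ℝ) : ℂ :=
  ∑ k ∈ F, if J - ⌈x / s⌉ = k then conj (Γ k (x + k * s)) / ‖Γ k (x + k * s)‖ else 0

section PhaseFun

variable {s : ℝ} {Γ : ℤ → ℝ → ℂ}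

theorem measurableSet_ceil_eq (s : ℝ) (J : ℤ) : MeasurableSet {t : ℝ | ⌈t / s⌉ = J} :=
  (Int.measurable_ceil.comp (measurable_id.div_const s)) (measurableSet_singleton J)

theorem measurable_phaseFun (hΓ : ∀ k, Measurable (Γ k)) (F : Finset ℤ) (J : ℤ) :
    Measurable (phaseFun s Γ F J) := by
  refine Finset.measurable_fun_sum _ fun k _ => Measurable.ite ?_ ?_ measurable_const
  · simpa only [sub_eq_iff_eq_add', ← sub_eq_iff_eq_add, eq_comm] using
      measurableSet_ceil_eq s (J - k)
  · have hk : Measurable fun x => Γ k (x + k * s) := (hΓ k).comp (measurable_add_const _)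
    exact (Complex.continuous_conj.measurable.comp hk).div
      (Complex.continuous_ofReal.measurable.comp hk.norm)

theorem enorm_phaseFun_le (F : Finset ℤ) (J : ℤ) (x : ℝ) : ‖phaseFun s Γ F J x‖ₑ ≤ (1 : ℝ≥0) := by
  rw [phaseFun, Finset.sum_ite_eq, ENNReal.coe_one]
  split_ifs
  · rw [← ofReal_norm, norm_div, RCLike.norm_conj, Complex.norm_real, norm_norm]
    exact ENNReal.ofReal_le_one.2 (div_self_le_one _)
  · simp

theorem exists_bddSupp_phaseFun (hs : 0 < s) (hΓ : ∀ k, Measurable (Γ k)) (F : Finset ℤ) (J : ℤ) :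
    ∃ R, BddSupp (phaseFun s Γ F J) 1 R := by
  refine ⟨(|J| + ∑ k ∈ F, |k| + 1 : ℤ) * s, measurable_phaseFun hΓ F J, enorm_phaseFun_le F J,
    fun x hx => ?_⟩
  rw [phaseFun, Finset.sum_ite_eq, if_neg fun hmem => hx.not_ge ?_]
  have hk := Finset.single_le_sum (f := fun k : ℤ => |k|) (fun _ _ => abs_nonneg _) hmem
  have hceil : |⌈x / s⌉| ≤ |J| + ∑ k ∈ F, |k| :=
    calc |⌈x / s⌉| = |J - (J - ⌈x / s⌉)| := by rw [sub_sub_cancel]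
      _ ≤ |J| + |J - ⌈x / s⌉| := abs_sub _ _
      _ ≤ _ := by gcongr
  have hlo := Int.le_ceil (x / s)
  have hhi := Int.ceil_lt_add_one (x / s)
  have hceil' : |(⌈x / s⌉ : ℝ)| ≤ (|J| + ∑ k ∈ F, |k| : ℤ) := by exact_mod_cast hceil
  obtain ⟨h1, h2⟩ := abs_le.1 hceil'
  rw [← div_le_iff₀ hs, ← abs_of_pos hs, ← abs_div, abs_le]
  push_cast at h1 h2 ⊢
  constructor <;> linarith

theorem kerSum_phaseFun (hs : s ≠ 0) (F : Finset ℤ) {J : ℤ} {t : ℝ} (ht : ⌈t / s⌉ = J) :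
    kerSum s Γ (phaseFun s Γ F J) t = ((∑ k ∈ F, ‖Γ k t‖ : ℝ) : ℂ) := by
  have hval (k : ℤ) :
      phaseFun s Γ F J (t - k * s) = if k ∈ F then conj (Γ k t) / ‖Γ k t‖ else 0 := by
    simp [phaseFun, ceil_sub_mul_div hs, ht]
  have hphase (z : ℂ) : z * (conj z / ‖z‖) = ‖z‖ := by
    rw [mul_div_assoc', Complex.mul_conj, Complex.normSq_eq_norm_sq]
    push_cast
    rw [sq, mul_self_div_self]
  rw [kerSum, tsum_eq_sum (s := F) fun k hk => by rw [hval, if_neg hk, mul_zero]]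
  push_cast
  exact Finset.sum_congr rfl fun k hk => by rw [hval, if_pos hk, hphase]

end PhaseFun

theorem ae_sum_enorm_autoCorr_le (ha : 0 < a) (hb : 0 < b)
    {T : LInftyZero →L[ℂ] Lp ℂ ∞ (volume : Measure ℝ)} (hT : ExtendsFrameOp a b g Subtype.val T)
    (F : Finset ℤ) : ∀ᵐ t : ℝ, ∑ k ∈ F, ‖autoCorr a b g k t‖ₑ ≤ ENNReal.ofReal (b * ‖T‖) := by
  have hs : 0 < b⁻¹ := inv_pos.2 hb
  have hbound (J : ℤ) : ∀ᵐ t : ℝ,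
      ‖kerSum b⁻¹ (autoCorr a b g) (phaseFun b⁻¹ (autoCorr a b g) F J) t‖ₑ
        ≤ ENNReal.ofReal (b * ‖T‖) := by
    obtain ⟨R, hf⟩ := exists_bddSupp_phaseFun hs (measurable_autoCorr (measurable_coeFn g)) F J
    simpa using ae_enorm_kerSum_le ha hb hT hf
  filter_upwards [ae_all_iff.2 hbound] with t ht
  have hsum : 0 ≤ ∑ k ∈ F, ‖autoCorr a b g k t‖ := Finset.sum_nonneg fun _ _ => norm_nonneg _
  have hJ := ht ⌈t / b⁻¹⌉
  rw [kerSum_phaseFun hs.ne' F rfl, ← ofReal_norm, Complex.norm_of_nonneg hsum,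
    ENNReal.ofReal_sum_of_nonneg fun _ _ => norm_nonneg _] at hJ
  simpa only [ofReal_norm] using hJ

theorem ccCondition_of_extends (ha : 0 < a) (hb : 0 < b)
    {T : LInftyZero →L[ℂ] Lp ℂ ∞ (volume : Measure ℝ)}
    (hT : ExtendsFrameOp a b g Subtype.val T) : CCCondition a b g := by
  refine ⟨b * ‖T‖ + 1, by positivity, ?_⟩
  filter_upwards [ae_all_iff.2 (ae_sum_enorm_autoCorr_le ha hb hT)] with t ht
  rw [ENNReal.tsum_eq_iSup_sum]
  exact iSup_le fun F => (ht F).trans (ENNReal.ofReal_le_ofReal (by linarith))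

end Necessity

theorem ccCondition_iff {a b : ℝ} (ha : 0 < a) (hb : 0 < b) (g : LTwo) :
    CCCondition a b g ↔
      (∀ (p : ℝ≥0∞) [Fact (1 ≤ p)], p ≠ ∞ →
        ∃ T : Lp ℂ p (volume : Measure ℝ) →L[ℂ] Lp ℂ p (volume : Measure ℝ),
          ExtendsFrameOp a b g id T) ∧
      (∃ T : LInftyZero →L[ℂ] Lp ℂ ∞ (volume : Measure ℝ),
        ExtendsFrameOp a b g Subtype.val T) := by
  refine ⟨fun ⟨B, _, hB⟩ => ?_, fun ⟨_, T, hT⟩ => ccCondition_of_extends ha hb hT⟩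
  have hG : IsSchurKernel b⁻¹ (autoCorr a b g) B.toNNReal :=
    isSchurKernel_autoCorr (measurable_coeFn g) hB
  exact ⟨fun p _ _ => ⟨(b : ℂ)⁻¹ • hG.toCLM p, hG.extendsFrameOp ha hb fun _ => rfl⟩,
    ((b : ℂ)⁻¹ • hG.toCLM ∞).comp LInftyZero.subtypeL, hG.extendsFrameOp ha hb fun _ => rfl⟩

/-! ### The localized lower bound -/

section LTwoNorm

variable {ι κ : Type*}

/-- The `ℓ²` norm of a family of extended nonnegative numbers. -/
noncomputable def ellTwoNorm (x : ι → ℝ≥0∞) : ℝ≥0∞ :=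
  (∑' j, x j ^ 2) ^ (1 / 2 : ℝ)

theorem ellTwoNorm_mono {x y : ι → ℝ≥0∞} (h : ∀ j, x j ≤ y j) : ellTwoNorm x ≤ ellTwoNorm y := by
  unfold ellTwoNorm
  gcongr with j
  exact h j

theorem ellTwoNorm_comp_equiv (e : κ ≃ ι) (x : ι → ℝ≥0∞) :
    ellTwoNorm (fun j => x (e j)) = ellTwoNorm x := by
  rw [ellTwoNorm, ellTwoNorm, e.tsum_eq fun j => x j ^ 2]

theorem rpow_half_sq (c : ℝ≥0∞) : (c ^ 2) ^ (1 / 2 : ℝ) = c := by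
  rw [← ENNReal.rpow_two, ← ENNReal.rpow_mul]
  norm_num

theorem ellTwoNorm_const_mul (c : ℝ≥0∞) (x : ι → ℝ≥0∞) :
    ellTwoNorm (fun j => c * x j) = c * ellTwoNorm x := by
  simp only [ellTwoNorm, mul_pow]
  rw [ENNReal.tsum_mul_left, ENNReal.mul_rpow_of_nonneg _ _ (by norm_num), rpow_half_sq]

theorem le_ellTwoNorm (x : ι → ℝ≥0∞) (j : ι) : x j ≤ ellTwoNorm x := by
  rw [← rpow_half_sq (x j), ellTwoNorm]
  gcongr
  exact ENNReal.le_tsum j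

theorem ellTwoNorm_le_tsum (x : ι → ℝ≥0∞) : ellTwoNorm x ≤ ∑' j, x j := by
  rw [← rpow_half_sq (∑' j, x j), ellTwoNorm]
  gcongr
  rw [sq, ← ENNReal.tsum_mul_right]
  gcongr with j
  rw [sq]
  gcongr
  exact ENNReal.le_tsum j

theorem ellTwoNorm_eq_iSup (x : ι → ℝ≥0∞) :
    ellTwoNorm x = ⨆ s : Finset ι, (∑ j ∈ s, x j ^ (2 : ℝ)) ^ (1 / 2 : ℝ) := by
  rw [ellTwoNorm, ENNReal.tsum_eq_iSup_sum]
  simp only [← ENNReal.rpow_two]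
  exact (ENNReal.orderIsoRpow (1 / 2 : ℝ) (by norm_num)).map_iSup _

theorem ellTwoNorm_add_le (x y : ι → ℝ≥0∞) :
    ellTwoNorm (fun j => x j + y j) ≤ ellTwoNorm x + ellTwoNorm y := by
  simp only [ellTwoNorm_eq_iSup]
  exact iSup_le fun s => (ENNReal.Lp_add_le s x y one_le_two).trans
    (add_le_add (le_iSup_of_le s le_rfl) (le_iSup_of_le s le_rfl))

theorem ellTwoNorm_sum_le (x : κ → ι → ℝ≥0∞) (t : Finset κ) :
    ellTwoNorm (fun j => ∑ k ∈ t, x k j) ≤ ∑ k ∈ t, ellTwoNorm (x k) := by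
  classical
  induction t using Finset.induction with
  | empty => simp [ellTwoNorm]
  | insert k t hk ih =>
    simp only [Finset.sum_insert hk]
    exact (ellTwoNorm_add_le _ _).trans (by gcongr)

theorem ellTwoNorm_tsum_le (x : κ → ι → ℝ≥0∞) :
    ellTwoNorm (fun j => ∑' k, x k j) ≤ ∑' k, ellTwoNorm (x k) := by
  rw [ellTwoNorm_eq_iSup]
  refine iSup_le fun s => ?_
  have hlim : Tendsto (fun t : Finset κ => (∑ j ∈ s, (∑ k ∈ t, x k j) ^ (2 : ℝ)) ^ (1 / 2 : ℝ))
      atTop (𝓝 ((∑ j ∈ s, (∑' k, x k j) ^ (2 : ℝ)) ^ (1 / 2 : ℝ))) :=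
    (tendsto_finsetSum s fun j _ => ENNReal.summable.hasSum.ennrpow_const 2).ennrpow_const _
  refine le_of_tendsto' hlim fun t => ?_
  calc (∑ j ∈ s, (∑ k ∈ t, x k j) ^ (2 : ℝ)) ^ (1 / 2 : ℝ)
      ≤ ellTwoNorm fun j => ∑ k ∈ t, x k j := by
        rw [ellTwoNorm_eq_iSup]
        exact le_iSup (fun s : Finset ι => (∑ j ∈ s, (∑ k ∈ t, x k j) ^ (2 : ℝ)) ^ (1 / 2 : ℝ)) s
    _ ≤ ∑ k ∈ t, ellTwoNorm (x k) := ellTwoNorm_sum_le x t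
    _ ≤ ∑' k, ellTwoNorm (x k) := ENNReal.sum_le_tsum t

end LTwoNorm

section Fiber

variable {s : ℝ} {Γ : ℤ → ℝ → ℂ} {C c : ℝ≥0} {f : ℝ → ℂ}

theorem measurable_kerSum (hΓ : ∀ k, Measurable (Γ k)) (hf : Measurable f) :
    Measurable (kerSum s Γ f) :=
  Measurable.tsum fun k => (hΓ k).mul (hf.comp (measurable_sub_const _))

theorem IsTranslInvariant.kerSum_indicator {E : Set ℝ} (hE : IsTranslInvariant s E) :
    kerSum s Γ (E.indicator f) = E.indicator (kerSum s Γ f) := by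
  ext t
  have hmem (k : ℤ) : t - k * s ∈ E ↔ t ∈ E := hE k t
  by_cases ht : t ∈ E <;> simp [kerSum, Set.indicator, hmem, ht]

theorem eLpNorm_two_sq {α : Type*} [MeasurableSpace α] (μ : Measure α) (f : α → ℂ) :
    eLpNorm f 2 μ ^ 2 = ∫⁻ t, ‖f t‖ₑ ^ 2 ∂μ := by
  simpa using eLpNorm_nnreal_pow_eq_lintegral (f := f) (μ := μ) (two_ne_zero' ℝ≥0)

theorem setLIntegral_enorm_kerSum_sq_ge
    (hc : ∀ φ : ℝ → ℂ, MemLp φ 2 → c * eLpNorm φ 2 ≤ eLpNorm (kerSum s Γ φ) 2)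
    (hf : MemLp f 2) {E : Set ℝ} (hEm : MeasurableSet E) (hE : IsTranslInvariant s E) :
    ∫⁻ t in E, (c * ‖f t‖ₑ) ^ 2 ≤ ∫⁻ t in E, ‖kerSum s Γ f t‖ₑ ^ 2 := by
  have h := pow_le_pow_left' (hc _ (hf.indicator hEm)) 2
  rw [mul_pow, hE.kerSum_indicator, eLpNorm_indicator_eq_eLpNorm_restrict hEm,
    eLpNorm_indicator_eq_eLpNorm_restrict hEm, eLpNorm_two_sq,
    eLpNorm_two_sq, ← lintegral_const_mul' _ _ (ENNReal.pow_ne_top ENNReal.coe_ne_top)] at h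
  simpa only [mul_pow] using h

theorem IsSchurKernel.fiberwise_lower_bound (hΓ : IsSchurKernel s Γ C) (hs : 0 < s)
    (hc : ∀ φ : ℝ → ℂ, MemLp φ 2 → c * eLpNorm φ 2 ≤ eLpNorm (kerSum s Γ φ) 2)
    (hfm : Measurable f) (hf : MemLp f 2) :
    ∀ᵐ t : ℝ, c * ellTwoNorm (fun j : ℤ => ‖f (t - j * s)‖ₑ)
      ≤ ellTwoNorm fun j : ℤ => ‖kerSum s Γ f (t - j * s)‖ₑ := by
  filter_upwards [ae_tsum_sub_le_of_setLIntegral_le hs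
    ((hfm.enorm.const_mul (c : ℝ≥0∞)).pow_const 2)
    ((measurable_kerSum hΓ.meas hfm).enorm.pow_const 2)
    (lintegral_enorm_sq_lt_top (hΓ.memLp_kerSum one_le_two hf)).ne
    fun E => setLIntegral_enorm_kerSum_sq_ge hc hf] with t ht
  rw [← ellTwoNorm_const_mul]
  exact ENNReal.rpow_le_rpow ht (by norm_num)

end Fiber

section ExpWeight

theorem abs_pow_sub_pow_le {r : ℝ} (hr0 : 0 ≤ r) (hr1 : r ≤ 1) {m n d : ℕ} (hmn : m ≤ n + d)
    (hnm : n ≤ m + d) : |r ^ m - r ^ n| ≤ (1 - r ^ d) * (r ^ m + r ^ n) := by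
  have hsub {i j : ℕ} (hji : j ≤ i + d) : r ^ i - r ^ j ≤ (1 - r ^ d) * (r ^ i + r ^ j) := by
    have h1 : r ^ i * r ^ d ≤ r ^ j := by
      rw [← pow_add]
      exact pow_le_pow_of_le_one hr0 hr1 hji
    have h2 : 0 ≤ (1 - r ^ d) * r ^ j :=
      mul_nonneg (sub_nonneg.2 (pow_le_one₀ hr0 hr1)) (pow_nonneg hr0 j)
    linarith
  rw [abs_sub_le_iff]
  exact ⟨hsub hnm, (hsub hmn).trans_eq (by rw [add_comm])⟩

/-- The weight `r ^ |i - J|` on the `i`-th cell `(s (i - 1), s i]` of the line. For `r < 1` it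
decays geometrically away from the `J`-th cell, but varies slowly if `r` is close to `1`. -/
noncomputable def expWeight (r : ℝ≥0) (s : ℝ) (J : ℤ) (t : ℝ) : ℝ≥0 :=
  r ^ (⌈t / s⌉ - J).natAbs

/-- The commutator of multiplication by a weight `expWeight r s J` with translation by `k s` is at
most `commFactor r k` relative to the weight. -/
noncomputable def commFactor (r : ℝ≥0) (k : ℤ) : ℝ≥0 :=
  1 - r ^ k.natAbs

variable {s : ℝ} {Γ : ℤ → ℝ → ℂ} {f : ℝ → ℂ} {r : ℝ≥0}

theorem measurable_expWeight (r : ℝ≥0) (s : ℝ) (J : ℤ) : Measurable (expWeight r s J) := by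
  have : Measurable fun i : ℤ => r ^ (i - J).natAbs := measurable_from_top
  exact this.comp (Int.measurable_ceil.comp (measurable_id.div_const s))

theorem expWeight_le_one (hr : r ≤ 1) (J : ℤ) (t : ℝ) : expWeight r s J t ≤ 1 :=
  pow_le_one₀ zero_le hr

theorem enorm_expWeight_sub_le (hs : s ≠ 0) (hr : r ≤ 1) (J k : ℤ) (t : ℝ) :
    ‖(expWeight r s J (t - k * s) - expWeight r s J t : ℂ)‖ₑ
      ≤ commFactor r k * (expWeight r s J t + expWeight r s J (t - k * s)) := by
  have h := abs_pow_sub_pow_le r.2 hr (d := k.natAbs)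
    (m := (⌈t / s⌉ - k - J).natAbs) (n := (⌈t / s⌉ - J).natAbs) (by lia) (by lia)
  rw [add_comm (expWeight r s J t : ℝ≥0∞), enorm_eq_nnnorm, ← Complex.ofReal_sub,
    Complex.nnnorm_real, expWeight, expWeight, ceil_sub_mul_div hs, commFactor]
  norm_cast
  rw [← NNReal.coe_le_coe, NNReal.coe_mul, NNReal.coe_sub (pow_le_one₀ zero_le hr)]
  simpa using h

theorem enorm_kerSum_expWeight_mul_le (hs : s ≠ 0) (hr : r ≤ 1) (J : ℤ) {t : ℝ}
    (h : Summable fun k : ℤ => Γ k t * f (t - k * s))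
    (h' : Summable fun k : ℤ => Γ k t * (expWeight r s J (t - k * s) * f (t - k * s))) :
    ‖kerSum s Γ (fun x => expWeight r s J x * f x) t‖ₑ
      ≤ expWeight r s J t * ‖kerSum s Γ f t‖ₑ + ∑' k : ℤ, commFactor r k * ‖Γ k t‖ₑ *
        ((expWeight r s J t + expWeight r s J (t - k * s)) * ‖f (t - k * s)‖ₑ) := by
  have hsplit : kerSum s Γ (fun x => expWeight r s J x * f x) t = expWeight r s J t * kerSum s Γ f t
      + ∑' k : ℤ, Γ k t * (expWeight r s J (t - k * s) - expWeight r s J t) * f (t - k * s) := by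
    rw [kerSum, kerSum, ← tsum_mul_left, ← sub_eq_iff_eq_add', ← h'.tsum_sub (h.mul_left _)]
    exact tsum_congr fun k => by ring
  have hnorm (w : ℝ≥0) : ‖(w : ℂ)‖ₑ = w := by simp [enorm, Complex.nnnorm_real]
  rw [hsplit]
  refine (enorm_add_le _ _).trans (add_le_add ?_ (enorm_tsum_le_tsum_enorm.trans ?_))
  · rw [enorm_mul, hnorm]
  · gcongr with k
    rw [enorm_mul, enorm_mul, mul_comm ‖Γ k t‖ₑ]
    refine (mul_le_mul_left (mul_le_mul_left (enorm_expWeight_sub_le hs hr J k t) _) _).trans_eq ?_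
    ring

end ExpWeight

section LocNorm

/-- The `ℓ²` norm of the values of `F` on the coset `t + s ℤ`, weighted by `r ^ |j|` so that the
value at `t` dominates. -/
noncomputable def locNorm (r : ℝ≥0) (s : ℝ) (F : ℝ → ℝ≥0∞) (t : ℝ) : ℝ≥0∞ :=
  ellTwoNorm fun j : ℤ => ((r ^ j.natAbs : ℝ≥0) : ℝ≥0∞) * F (t - j * s)

variable {s : ℝ} {Γ : ℤ → ℝ → ℂ} {W : ℤ → ℝ → ℝ≥0∞} {f : ℝ → ℂ} {F : ℝ → ℝ≥0∞} {r c C D ε : ℝ≥0}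
  {p : ℝ≥0∞}

theorem le_locNorm (r : ℝ≥0) (s : ℝ) (F : ℝ → ℝ≥0∞) (t : ℝ) : F t ≤ locNorm r s F t := by
  simpa [locNorm] using le_ellTwoNorm (fun j : ℤ => ((r ^ j.natAbs : ℝ≥0) : ℝ≥0∞) * F (t - j * s)) 0

theorem locNorm_le_kerAbs (t : ℝ) :
    locNorm r s F t ≤ kerAbs s (fun j _ => ((r ^ j.natAbs : ℝ≥0) : ℝ≥0∞)) F t :=
  ellTwoNorm_le_tsum _

theorem aemeasurable_locNorm (hF : AEMeasurable F) : AEMeasurable (locNorm r s F) :=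
  (AEMeasurable.tsum fun _ =>
    ((aemeasurable_comp_sub hF _).const_mul _).pow_const 2).pow_const _

theorem eLpNorm_locNorm_le (hp : 1 ≤ p) (hD : ∑' j : ℤ, ((r ^ j.natAbs : ℝ≥0) : ℝ≥0∞) ≤ D)
    (hF : AEMeasurable F) : eLpNorm (locNorm r s F) p ≤ D * eLpNorm F p :=
  (eLpNorm_mono_enorm fun t => by simpa only [enorm_eq_self] using locNorm_le_kerAbs t).trans
    (eLpNorm_kerAbs_le hp (fun _ => measurable_const) (ae_of_all _ fun _ => hD)
      (ae_of_all _ fun _ => hD) hF)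

theorem ellTwoNorm_shift_eq_locNorm (k : ℤ) (t : ℝ) :
    ellTwoNorm (fun j : ℤ => ((r ^ j.natAbs : ℝ≥0) : ℝ≥0∞) * F (t - j * s - k * s))
      = locNorm r s F (t - k * s) := by
  simp only [locNorm, sub_right_comm]

theorem ellTwoNorm_weighted_shift_eq_locNorm (k : ℤ) (t : ℝ) :
    ellTwoNorm (fun j : ℤ => ((r ^ (j + k).natAbs : ℝ≥0) : ℝ≥0∞) * F (t - j * s - k * s))
      = locNorm r s F t := by
  rw [locNorm, ← ellTwoNorm_comp_equiv (Equiv.addRight k)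
    fun j : ℤ => ((r ^ j.natAbs : ℝ≥0) : ℝ≥0∞) * F (t - j * s)]
  simp [sub_sub, add_mul]

theorem ellTwoNorm_commutator_le (t : ℝ) :
    ellTwoNorm (fun j : ℤ => ∑' k : ℤ, W k t *
        ((((r ^ j.natAbs : ℝ≥0) : ℝ≥0∞) + ((r ^ (j + k).natAbs : ℝ≥0) : ℝ≥0∞)) *
          F (t - j * s - k * s)))
      ≤ kerAbs s W (locNorm r s F) t + (∑' k : ℤ, W k t) * locNorm r s F t := by
  rw [kerAbs, ← ENNReal.tsum_mul_right, ← ENNReal.tsum_add]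
  refine (ellTwoNorm_tsum_le _).trans (ENNReal.tsum_le_tsum fun k => ?_)
  rw [ellTwoNorm_const_mul, ← mul_add]
  gcongr
  simp only [add_mul]
  refine (ellTwoNorm_add_le _ _).trans_eq ?_
  rw [ellTwoNorm_shift_eq_locNorm, ellTwoNorm_weighted_shift_eq_locNorm]

theorem memLp_expWeight_mul (hr : r ≤ 1) (J : ℤ) (hf : MemLp f p) :
    MemLp (fun x => expWeight r s J x * f x) p := by
  have hm : Measurable fun x => (expWeight r s J x : ℂ) := by
    have := measurable_expWeight r s J
    fun_prop
  refine hf.of_le (hm.aestronglyMeasurable.mul hf.1) (ae_of_all _ fun x => ?_)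
  rw [norm_mul]
  refine mul_le_of_le_one_left (norm_nonneg _) ?_
  simpa using expWeight_le_one hr J x

theorem IsSchurKernel.ae_mul_locNorm_le (hΓ : IsSchurKernel s Γ C) (hs : 0 < s) (hr : r ≤ 1)
    (hc : ∀ φ : ℝ → ℂ, MemLp φ 2 → c * eLpNorm φ 2 ≤ eLpNorm (kerSum s Γ φ) 2)
    (hW : ∀ᵐ t : ℝ, ∀ j k : ℤ, commFactor r k * ‖Γ k (t - j * s)‖ₑ ≤ W k t)
    (hfm : Measurable f) (hf : MemLp f 2) :
    ∀ᵐ t : ℝ, c * locNorm r s (fun x => ‖f x‖ₑ) t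
      ≤ locNorm r s (fun x => ‖kerSum s Γ f x‖ₑ) t
        + (kerAbs s W (locNorm r s fun x => ‖f x‖ₑ) t
          + (∑' k : ℤ, W k t) * locNorm r s (fun x => ‖f x‖ₑ) t) := by
  have hmeas (J : ℤ) : Measurable fun x => expWeight r s J x * f x := by
    have := measurable_expWeight r s J
    fun_prop
  filter_upwards [hW, ae_forall_sub (hΓ.summable_ae one_le_two hf) s,
    ae_all_iff.2 fun J => ae_forall_sub (hΓ.summable_ae one_le_two (memLp_expWeight_mul hr J hf)) s,
    ae_all_iff.2 fun J => hΓ.fiberwise_lower_bound hs hc (hmeas J) (memLp_expWeight_mul hr J hf)]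
    with t hWt hsum hsum' hfib
  have hweight (j : ℤ) : expWeight r s ⌈t / s⌉ (t - j * s) = r ^ j.natAbs := by
    rw [expWeight, ceil_sub_mul_div hs.ne', sub_sub_cancel_left, Int.natAbs_neg]
  have hweight' (j k : ℤ) :
      expWeight r s ⌈t / s⌉ (t - j * s - k * s) = r ^ (j + k).natAbs := by
    rw [← hweight]
    push_cast
    ring_nf
  have hnorm (w : ℝ≥0) : ‖(w : ℂ)‖ₑ = w := by simp [enorm, Complex.nnnorm_real]
  have hleft := hfib ⌈t / s⌉
  simp only [enorm_mul, hnorm, hweight] at hleft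
  refine hleft.trans ((ellTwoNorm_mono fun j => ?_).trans ((ellTwoNorm_add_le _ _).trans
    (add_le_add_right (ellTwoNorm_commutator_le t) _)))
  refine (enorm_kerSum_expWeight_mul_le hs.ne' hr _ (hsum j) (hsum' _ j)).trans ?_
  rw [hweight]
  gcongr with k
  · exact hWt j k
  · rw [hweight']

theorem mul_eLpNorm_le_of_ae {α : Type*} [MeasurableSpace α] {μ : Measure α} {F G : α → ℝ≥0∞}
    (h : ∀ᵐ t ∂μ, c * F t ≤ G t) : c * eLpNorm F p μ ≤ eLpNorm G p μ := by
  rcases eq_or_ne c 0 with rfl | hc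
  · simp
  have hc' : (c : ℝ≥0∞) ≠ 0 := ENNReal.coe_ne_zero.2 hc
  rw [ENNReal.mul_le_iff_le_inv hc' ENNReal.coe_ne_top, ← ENNReal.coe_inv hc]
  refine eLpNorm_le_mul_eLpNorm_of_ae_le_mul' (h.mono fun t ht => ?_) p
  rwa [ENNReal.coe_inv hc, ← ENNReal.mul_le_iff_le_inv hc' ENNReal.coe_ne_top]

theorem IsSchurKernel.mul_eLpNorm_locNorm_le (hΓ : IsSchurKernel s Γ C) (hs : 0 < s) (hr : r ≤ 1)
    (hc : ∀ φ : ℝ → ℂ, MemLp φ 2 → c * eLpNorm φ 2 ≤ eLpNorm (kerSum s Γ φ) 2)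
    (hW : ∀ᵐ t : ℝ, ∀ j k : ℤ, commFactor r k * ‖Γ k (t - j * s)‖ₑ ≤ W k t)
    (hWm : ∀ k, Measurable (W k)) (row : ∀ᵐ t : ℝ, ∑' k : ℤ, W k t ≤ ε)
    (col : ∀ᵐ t : ℝ, ∑' k : ℤ, W k (t + k * s) ≤ ε) (hp : 1 ≤ p)
    (hfm : Measurable f) (hf : MemLp f 2) :
    c * eLpNorm (locNorm r s fun x => ‖f x‖ₑ) p
      ≤ eLpNorm (locNorm r s fun x => ‖kerSum s Γ f x‖ₑ) p
        + 2 * ε * eLpNorm (locNorm r s fun x => ‖f x‖ₑ) p := by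
  set L := locNorm r s fun x => ‖f x‖ₑ
  have hLm : AEMeasurable L := aemeasurable_locNorm hfm.enorm.aemeasurable
  have hLm' : AEMeasurable (locNorm r s fun x => ‖kerSum s Γ f x‖ₑ) :=
    aemeasurable_locNorm (measurable_kerSum hΓ.meas hfm).enorm.aemeasurable
  have hKm : AEMeasurable (kerAbs s W L) := aemeasurable_kerAbs hWm hLm
  have hPm : AEMeasurable fun t => (∑' k : ℤ, W k t) * L t :=
    (AEMeasurable.tsum fun k => (hWm k).aemeasurable).mul hLm
  refine (mul_eLpNorm_le_of_ae (hΓ.ae_mul_locNorm_le hs hr hc hW hfm hf)).trans ?_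
  refine (eLpNorm_add_le hLm'.aestronglyMeasurable (hKm.add hPm).aestronglyMeasurable hp).trans
    (add_le_add_right ?_ _)
  rw [two_mul, add_mul]
  refine (eLpNorm_add_le hKm.aestronglyMeasurable hPm.aestronglyMeasurable hp).trans
    (add_le_add (WeylHeisenberg.eLpNorm_kerAbs_le hp hWm row col hLm) ?_)
  exact eLpNorm_le_mul_eLpNorm_of_ae_le_mul' (row.mono fun t ht => mul_le_mul_left ht _) p

theorem IsSchurKernel.mul_eLpNorm_le (hΓ : IsSchurKernel s Γ C) (hs : 0 < s) (hr : r ≤ 1)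
    (hD : ∑' j : ℤ, ((r ^ j.natAbs : ℝ≥0) : ℝ≥0∞) ≤ D)
    (hc : ∀ φ : ℝ → ℂ, MemLp φ 2 → ↑(4 * ε) * eLpNorm φ 2 ≤ eLpNorm (kerSum s Γ φ) 2)
    (hW : ∀ᵐ t : ℝ, ∀ j k : ℤ, commFactor r k * ‖Γ k (t - j * s)‖ₑ ≤ W k t)
    (hWm : ∀ k, Measurable (W k)) (row : ∀ᵐ t : ℝ, ∑' k : ℤ, W k t ≤ ε)
    (col : ∀ᵐ t : ℝ, ∑' k : ℤ, W k (t + k * s) ≤ ε) (hp : 1 ≤ p)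
    (hfm : Measurable f) (hf : MemLp f 2) (hfp : MemLp f p) :
    2 * ε * eLpNorm f p ≤ D * eLpNorm (kerSum s Γ f) p := by
  set L := locNorm r s fun x => ‖f x‖ₑ
  have hLtop : eLpNorm L p < ∞ := (eLpNorm_locNorm_le hp hD hfm.enorm.aemeasurable).trans_lt
    (ENNReal.mul_lt_top ENNReal.coe_lt_top (by simpa only [eLpNorm_enorm] using hfp.2))
  have hle : eLpNorm f p ≤ eLpNorm L p := (eLpNorm_enorm f).symm.trans_le
    (eLpNorm_mono_enorm fun t => by simpa only [enorm_eq_self] using le_locNorm r s _ t)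
  have habsorb : 2 * ε * eLpNorm L p ≤ eLpNorm (locNorm r s fun x => ‖kerSum s Γ f x‖ₑ) p := by
    have h := hΓ.mul_eLpNorm_locNorm_le hs hr hc hW hWm row col hp hfm hf
    refine (ENNReal.add_le_add_iff_right (a := 2 * ε * eLpNorm L p) (by finiteness)).1 ?_
    refine le_trans (le_of_eq ?_) h
    push_cast
    ring
  refine (mul_le_mul_right hle _).trans (habsorb.trans ?_)
  simpa only [eLpNorm_enorm] using eLpNorm_locNorm_le hp hD
    (measurable_kerSum hΓ.meas hfm).enorm.aemeasurable

end LocNorm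

/-! ### Invertibility -/

section Perturbation

variable {𝕜 E : Type*} [RCLike 𝕜] [NormedAddCommGroup E] [NormedSpace 𝕜 E] [CompleteSpace E]
  {T : E →L[𝕜] E} {c lam mu : ℝ}

theorem isUnit_add_smul_of_abs_sub_lt (hc : 0 < c) (h : ∀ x, c * ‖x‖ ≤ ‖T x + (lam : 𝕜) • x‖)
    (hu : IsUnit (T + (lam : 𝕜) • 1)) (hmu : |lam - mu| < c) : IsUnit (T + (mu : 𝕜) • 1) := by
  obtain ⟨U, hU⟩ := hu
  have hUinv : ‖(↑U⁻¹ : E →L[𝕜] E)‖ ≤ c⁻¹ := by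
    refine ContinuousLinearMap.opNorm_le_bound _ (by positivity) fun y => ?_
    have hy : T ((↑U⁻¹ : E →L[𝕜] E) y) + (lam : 𝕜) • (↑U⁻¹ : E →L[𝕜] E) y = y := by
      have hUy := DFunLike.congr_fun U.mul_inv y
      rw [hU] at hUy
      exact hUy
    rw [← div_eq_inv_mul, le_div_iff₀' hc]
    simpa only [hy] using h ((↑U⁻¹ : E →L[𝕜] E) y)
  have hsmall : ‖((lam - mu : ℝ) : 𝕜) • (↑U⁻¹ : E →L[𝕜] E)‖ < 1 := by
    rw [norm_smul, RCLike.norm_ofReal]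
    calc |lam - mu| * ‖(↑U⁻¹ : E →L[𝕜] E)‖ ≤ |lam - mu| * c⁻¹ := by gcongr
      _ < c * c⁻¹ := by gcongr
      _ = 1 := mul_inv_cancel₀ hc.ne'
  have hfactor : T + (mu : 𝕜) • 1
      = U * (1 - ((lam - mu : ℝ) : 𝕜) • (↑U⁻¹ : E →L[𝕜] E)) := by
    rw [mul_sub, mul_one, mul_smul_comm, U.mul_inv, hU, RCLike.ofReal_sub, sub_smul]
    abel
  rw [hfactor]
  exact U.isUnit.mul (isUnit_one_sub_of_norm_lt_one hsmall)

theorem isUnit_add_smul_of_norm_lt (h : ‖T‖ < lam) : IsUnit (T + (lam : 𝕜) • 1) := by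
  have hlam : 0 < lam := (norm_nonneg T).trans_lt h
  have hlam' : (lam : 𝕜) ≠ 0 := RCLike.ofReal_ne_zero.2 hlam.ne'
  have hsmall : ‖(lam : 𝕜)⁻¹ • -T‖ < 1 := by
    rwa [norm_smul, norm_neg, norm_inv, RCLike.norm_ofReal, abs_of_pos hlam, ← div_eq_inv_mul,
      div_lt_one hlam]
  have hfactor : T + (lam : 𝕜) • 1 = (lam : 𝕜) • (1 - (lam : 𝕜)⁻¹ • -T) := by
    rw [smul_sub, smul_inv_smul₀ hlam', sub_neg_eq_add, add_comm]
  rw [hfactor]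
  exact (isUnit_one_sub_of_norm_lt_one hsmall).smul (Units.mk0 _ hlam')

-- `T + λ` is invertible for large `λ`, and invertibility propagates down to `λ = 0` in steps of
-- length `c / 2`.
theorem isUnit_of_forall_le_norm_add_smul (hc : 0 < c)
    (h : ∀ lam : ℝ, 0 ≤ lam → ∀ x, c * ‖x‖ ≤ ‖T x + (lam : 𝕜) • x‖) : IsUnit T := by
  have hstep : ∀ n : ℕ, IsUnit (T + ((max (‖T‖ + 1 - n * (c / 2)) 0 : ℝ) : 𝕜) • 1) := by
    intro n
    induction n with
    | zero =>
      refine isUnit_add_smul_of_norm_lt (lt_max_of_lt_left ?_)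
      simp
    | succ n ih =>
      refine isUnit_add_smul_of_abs_sub_lt hc (h _ (le_max_right _ _)) ih ?_
      refine (abs_max_sub_max_le_abs _ _ _).trans_lt ?_
      rw [Nat.cast_succ, abs_of_nonneg] <;> linarith
  obtain ⟨n, hn⟩ := exists_nat_ge ((‖T‖ + 1) / (c / 2))
  have hn0 : max (‖T‖ + 1 - n * (c / 2)) 0 = 0 :=
    max_eq_right (sub_nonpos.2 ((div_le_iff₀ (by positivity)).1 hn))
  simpa only [hn0, RCLike.ofReal_zero, zero_smul, add_zero] using hstep n

end Perturbation

/-- The kernel of `f ↦ Γ f + z f`. -/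
noncomputable def addDiag (Γ : ℤ → ℝ → ℂ) (z : ℂ) (k : ℤ) (t : ℝ) : ℂ :=
  Γ k t + if k = 0 then z else 0

section AddDiag

variable {s : ℝ} {Γ : ℤ → ℝ → ℂ} {C : ℝ≥0} {p : ℝ≥0∞}

theorem enorm_addDiag_le (z : ℂ) (k : ℤ) (t : ℝ) :
    ‖addDiag Γ z k t‖ₑ ≤ ‖Γ k t‖ₑ + if k = 0 then ‖z‖ₑ else 0 := by
  refine (enorm_add_le _ _).trans_eq ?_
  split_ifs <;> simp

theorem IsSchurKernel.addDiag (hΓ : IsSchurKernel s Γ C) (z : ℂ) :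
    IsSchurKernel s (addDiag Γ z) (C + ‖z‖₊) := by
  have hsum : ∀ x : ℤ → ℝ, ∑' k, ‖Γ k (x k)‖ₑ ≤ C →
      ∑' k, ‖WeylHeisenberg.addDiag Γ z k (x k)‖ₑ ≤ ((C + ‖z‖₊ : ℝ≥0) : ℝ≥0∞) := by
    intro x hx
    refine (ENNReal.tsum_le_tsum fun k => enorm_addDiag_le z k (x k)).trans ?_
    rw [ENNReal.tsum_add, tsum_ite_eq, ENNReal.coe_add]
    exact add_le_add_left hx _
  exact ⟨fun k => (hΓ.meas k).add_const _, hΓ.row.mono fun t => hsum fun _ => t,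
    hΓ.col.mono fun t => hsum fun k => t + k * s⟩

theorem kerSum_addDiag {f : ℝ → ℂ} {t : ℝ} (z : ℂ)
    (h : Summable fun k : ℤ => Γ k t * f (t - k * s)) :
    kerSum s (addDiag Γ z) f t = kerSum s Γ f t + z * f t := by
  have hdiag : HasSum (fun k : ℤ => (if k = 0 then z else 0) * f (t - k * s)) (z * f t) := by
    convert hasSum_ite_eq (0 : ℤ) (z * f t) using 2 with k
    by_cases hk : k = 0 <;> simp [hk]
  simp only [kerSum, addDiag, add_mul]
  rw [h.tsum_add hdiag.summable, hdiag.tsum_eq]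

theorem IsSchurKernel.toCLM_addDiag [Fact (1 ≤ p)] (hΓ : IsSchurKernel s Γ C) (z : ℂ)
    (f : Lp ℂ p (volume : Measure ℝ)) : (hΓ.addDiag z).toCLM p f = hΓ.toCLM p f + z • f := by
  refine Lp.ext ?_
  filter_upwards [(hΓ.addDiag z).toCLM_ae f, hΓ.toCLM_ae f, Lp.coeFn_add (hΓ.toCLM p f) (z • f),
    Lp.coeFn_smul z f, hΓ.summable_ae Fact.out (Lp.memLp f)] with t h1 h2 h3 h4 h5
  rw [h1, h3, Pi.add_apply, h2, h4, Pi.smul_apply, smul_eq_mul, kerSum_addDiag z h5]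

end AddDiag

section Closure

variable {s : ℝ} {Γ : ℤ → ℝ → ℂ} {C : ℝ≥0} {p : ℝ≥0∞}

theorem mul_norm_le_mul_norm_iff [Fact (1 ≤ p)] {c D : ℝ≥0} {u w : Lp ℂ p (volume : Measure ℝ)}
    {f h : ℝ → ℂ} (hu : u =ᵐ[volume] f) (hw : w =ᵐ[volume] h) :
    c * ‖u‖ ≤ D * ‖w‖ ↔ c * eLpNorm f p ≤ D * eLpNorm h p := by
  rw [← eLpNorm_congr_ae hu, ← eLpNorm_congr_ae hw, ← Lp.enorm_def, ← Lp.enorm_def,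
    enorm_eq_nnnorm, enorm_eq_nnnorm]
  exact_mod_cast Iff.rfl

theorem IsSchurKernel.mul_norm_le_of_bddSupp [Fact (1 ≤ p)] (hΓ : IsSchurKernel s Γ C)
    {c D : ℝ≥0} (h : ∀ f M R, BddSupp f M R → c * eLpNorm f p ≤ D * eLpNorm (kerSum s Γ f) p)
    {u : Lp ℂ p (volume : Measure ℝ)} (hu : u ∈ closure (bddSuppClasses p)) :
    c * ‖u‖ ≤ D * ‖hΓ.toCLM p u‖ := by
  refine closure_minimal (fun u hu => ?_) (isClosed_le (f := fun u => c * ‖u‖)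
    (g := fun u => D * ‖hΓ.toCLM p u‖) (by fun_prop) (by fun_prop)) hu
  obtain ⟨f, M, R, hf, huf⟩ := hu
  exact (mul_norm_le_mul_norm_iff huf ((hΓ.toCLM_ae u).trans (kerSum_congr_ae huf))).2 (h f M R hf)

theorem compactlySupportedLInfty_subset_bddSuppClasses :
    (compactlySupportedLInfty : Set (Lp ℂ ∞ (volume : Measure ℝ))) ⊆ bddSuppClasses ∞ := by
  rintro u ⟨K, hK, hu⟩
  obtain ⟨R, hR⟩ := hK.isBounded.subset_closedBall 0
  set N : Set ℝ := Metric.closedBall 0 R ∩ {t | ‖u t‖ ≤ ‖u‖}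
  have hN : MeasurableSet N :=
    measurableSet_closedBall.inter (measurableSet_le (measurable_coeFn u).norm measurable_const)
  refine ⟨N.indicator u, ‖u‖₊, R, ⟨(measurable_coeFn u).indicator hN, fun t => ?_, fun t ht => ?_⟩,
    ?_⟩
  · by_cases ht : t ∈ N
    · rw [Set.indicator_of_mem ht]
      exact_mod_cast ht.2
    · simp [Set.indicator_of_notMem ht]
  · refine Set.indicator_of_notMem (fun htN => ht.not_ge ?_) _
    simpa using htN.1
  · filter_upwards [hu, enorm_ae_le_eLpNormEssSup u volume] with t hsupp hle
    rw [← eLpNorm_exponent_top, ← Lp.enorm_def] at hle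
    by_cases ht : t ∈ Metric.closedBall 0 R
    · exact (Set.indicator_of_mem (show t ∈ N from ⟨ht, enorm_le_iff_norm_le.1 hle⟩) _).symm
    · rw [Set.indicator_of_notMem fun h => ht h.1, hsupp fun h => ht (hR h)]

theorem LInftyZero_subset_closure_bddSuppClasses :
    (LInftyZero : Set (Lp ℂ ∞ (volume : Measure ℝ))) ⊆ closure (bddSuppClasses ∞) :=
  closure_mono compactlySupportedLInfty_subset_bddSuppClasses

end Closure

section Hilbert

variable {ι H : Type*} [NormedAddCommGroup H] [InnerProductSpace ℂ H] {v : ι → H} {u w : H}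

theorem hasSum_norm_inner_sq (h : HasSum (fun i => (inner ℂ (v i) u : ℂ) • v i) w) :
    HasSum (fun i => ‖inner ℂ (v i) u‖ ^ 2) (inner ℂ u w : ℂ).re := by
  refine (Complex.hasSum_re (h.mapL (innerSL ℂ u))).congr_fun fun i => ?_
  rw [innerSL_apply_apply, inner_smul_right, inner_mul_inner_re]

theorem mul_norm_le_norm_add_smul {A lam : ℝ}
    (h : HasSum (fun i => (inner ℂ (v i) u : ℂ) • v i) w)
    (hA : A * ‖u‖ ^ 2 ≤ ∑' i, ‖inner ℂ (v i) u‖ ^ 2) (hlam : 0 ≤ lam) :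
    A * ‖u‖ ≤ ‖w + (lam : ℂ) • u‖ := by
  rcases eq_or_ne u 0 with rfl | hu
  · simp
  refine le_of_mul_le_mul_left ?_ (norm_pos_iff.2 hu)
  have hre : (inner ℂ u ((lam : ℂ) • u) : ℂ).re = lam * ‖u‖ ^ 2 := by
    rw [inner_smul_right, inner_self_eq_norm_sq_to_K, Complex.re_ofReal_mul]
    norm_cast
  calc ‖u‖ * (A * ‖u‖) = A * ‖u‖ ^ 2 := by ring
    _ ≤ (inner ℂ u w : ℂ).re := by rwa [← (hasSum_norm_inner_sq h).tsum_eq]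
    _ ≤ (inner ℂ u (w + (lam : ℂ) • u) : ℂ).re := by
        rw [inner_add_right, Complex.add_re, hre]
        exact le_add_of_nonneg_right (by positivity)
    _ ≤ ‖u‖ * ‖w + (lam : ℂ) • u‖ := (Complex.re_le_norm _).trans (norm_inner_le_norm _ _)

end Hilbert

theorem IsSchurKernel.exists_mul_norm_le_of_isFrame {a b : ℝ} {g : LTwo} {C : ℝ≥0} (ha : 0 < a)
    (hb : 0 < b) (hG : IsSchurKernel b⁻¹ (autoCorr a b g) C) (hfr : IsFrame (whSystem a b g)) :
    ∃ c : ℝ≥0, 0 < c ∧ ∀ lam : ℝ, 0 ≤ lam → ∀ u : LTwo,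
      c * ‖u‖ ≤ ‖hG.toCLM 2 u + (lam : ℂ) • u‖ := by
  obtain ⟨A, B, hA, hAB⟩ := hfr
  refine ⟨⟨b * A, by positivity⟩, mul_pos hb hA, fun lam hlam u => ?_⟩
  have hle := mul_norm_le_norm_add_smul (hG.isFrameOpValue ha hb u) (hAB u).2.1
    (mul_nonneg (inv_nonneg.2 hb.le) hlam)
  rw [Complex.ofReal_mul, Complex.ofReal_inv, mul_smul, ← smul_add, norm_smul, norm_inv,
    Complex.norm_of_nonneg hb.le, ← div_eq_inv_mul, le_div_iff₀' hb] at hle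
  rwa [← mul_assoc] at hle

section Majorant

variable {s : ℝ} {Γ : ℤ → ℝ → ℂ} {C r : ℝ≥0}

/-- The largest modulus of the entry `Γₖ` along the orbit `t + s ℤ`. -/
noncomputable def orbitSup (s : ℝ) (Γ : ℤ → ℝ → ℂ) (k : ℤ) (t : ℝ) : ℝ≥0∞ :=
  ⨆ j : ℤ, ‖Γ k (t - j * s)‖ₑ

theorem measurable_orbitSup (hΓ : ∀ k, Measurable (Γ k)) (k : ℤ) : Measurable (orbitSup s Γ k) :=
  Measurable.iSup fun _ => ((hΓ k).comp (measurable_sub_const _)).enorm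

theorem orbitSup_add_mul (k l : ℤ) (t : ℝ) : orbitSup s Γ k (t + l * s) = orbitSup s Γ k t := by
  refine (Equiv.subRight l).iSup_congr fun j => ?_
  rw [Equiv.subRight_apply]
  congr 2
  push_cast
  ring

theorem commFactor_mul_enorm_addDiag_le (z : ℂ) (j k : ℤ) (t : ℝ) :
    commFactor r k * ‖addDiag Γ z k (t - j * s)‖ₑ ≤ commFactor r k * orbitSup s Γ k t := by
  rcases eq_or_ne k 0 with rfl | hk
  · simp [commFactor]
  · rw [addDiag, if_neg hk, add_zero]
    gcongr
    exact le_iSup (fun j : ℤ => ‖Γ k (t - j * s)‖ₑ) j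

theorem orbitSup_le_sum {n : ℕ} (hn : 0 < n) (hper : ∀ k, Function.Periodic (Γ k) (n * s))
    (k : ℤ) (t : ℝ) : orbitSup s Γ k t ≤ ∑ l ∈ Finset.range n, ‖Γ k (t - l * s)‖ₑ := by
  refine iSup_le fun j => ?_
  have hn' : (n : ℤ) ≠ 0 := by exact_mod_cast hn.ne'
  obtain ⟨l, hl⟩ := Int.eq_ofNat_of_zero_le (Int.emod_nonneg j hn')
  have hln : l < n := by exact_mod_cast hl ▸ Int.emod_lt_of_pos j (by exact_mod_cast hn)
  have hj : (j : ℝ) = l + n * (j / n : ℤ) := by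
    rw [← Int.emod_add_mul_ediv j n, hl]
    push_cast
    simp [Int.add_mul_ediv_left _ _ hn', Int.ediv_eq_zero_of_lt, hln]
  have hshift : Γ k (t - j * s) = Γ k (t - l * s) := by
    rw [← ((hper k).int_mul (j / n)) (t - j * s), hj]
    congr 1
    ring
  rw [hshift]
  exact Finset.single_le_sum (f := fun l : ℕ => ‖Γ k (t - l * s)‖ₑ) (fun _ _ => zero_le)
    (Finset.mem_range.2 hln)

theorem tsum_commFactor_mul_le {w : ℤ → ℝ≥0∞} {K : ℕ} {η : ℝ≥0} (hr : r ≤ 1)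
    (hη : 1 - r ^ K ≤ η) :
    ∑' k, commFactor r k * w k ≤ η * ∑' k, w k + ∑' k : {k : ℤ // (K : ℤ) ≤ |k|}, w k := by
  rw [show ∑' k : {k : ℤ // (K : ℤ) ≤ |k|}, w k = _ from tsum_subtype {k : ℤ | (K : ℤ) ≤ |k|} w,
    ← ENNReal.tsum_mul_left, ← ENNReal.tsum_add]
  refine ENNReal.tsum_le_tsum fun k => ?_
  by_cases hk : (K : ℤ) ≤ |k|
  · rw [Set.indicator_of_mem (show k ∈ {k : ℤ | (K : ℤ) ≤ |k|} from hk)]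
    refine le_add_of_nonneg_of_le zero_le (mul_le_of_le_one_left zero_le ?_)
    exact_mod_cast tsub_le_self (a := (1 : ℝ≥0))
  · have hkK : k.natAbs ≤ K := by rw [Int.abs_eq_natAbs] at hk; omega
    refine le_add_of_le_of_nonneg ?_ zero_le
    gcongr
    exact (tsub_le_tsub_left (pow_le_pow_of_le_one zero_le hr hkK) 1).trans hη

theorem exists_lt_one_sub_pow_le (K : ℕ) {η : ℝ≥0} (hη : 0 < η) :
    ∃ r : ℝ≥0, r < 1 ∧ 1 - r ^ K ≤ η := by
  have : (𝓝[<] (1 : ℝ≥0)).NeBot := nhdsLT_neBot_of_exists_lt ⟨0, zero_lt_one⟩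
  have hcont : Tendsto (fun r : ℝ≥0 => 1 - r ^ K) (𝓝[<] 1) (𝓝 (1 - 1 ^ K)) :=
    ((continuous_const.sub (continuous_pow K)).tendsto 1).mono_left nhdsWithin_le_nhds
  rw [one_pow, tsub_self] at hcont
  obtain ⟨r, hrη, hr⟩ := ((hcont.eventually (ge_mem_nhds hη)).and self_mem_nhdsWithin).exists
  exact ⟨r, hr, hrη⟩

theorem exists_tsum_commFactor_mul_orbitSup_le {n : ℕ} (hn : 0 < n)
    (hper : ∀ k, Function.Periodic (Γ k) (n * s)) (hrow : ∀ᵐ t : ℝ, ∑' k : ℤ, ‖Γ k t‖ₑ ≤ C)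
    (htight : TightRows Γ) {ε : ℝ≥0} (hε : 0 < ε) :
    ∃ r : ℝ≥0, r < 1 ∧ ∀ᵐ t : ℝ, ∑' k, commFactor r k * orbitSup s Γ k t ≤ ε := by
  have : (0 : ℝ≥0) < n := by exact_mod_cast hn
  obtain ⟨δ, hδ, hδε⟩ : ∃ δ : ℝ≥0, 0 < δ ∧ n * (δ * C + δ) ≤ ε := by
    refine ⟨ε / (n * (C + 1)), by positivity, le_of_eq ?_⟩
    field_simp
  obtain ⟨K, hK⟩ := htight δ (by exact_mod_cast hδ)
  obtain ⟨r, hr, hrK⟩ := exists_lt_one_sub_pow_le K hδ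
  refine ⟨r, hr, ?_⟩
  filter_upwards [ae_forall_sub hrow s, ae_forall_sub hK s] with t hrow htail
  calc ∑' k, commFactor r k * orbitSup s Γ k t
      ≤ ∑' k, ∑ l ∈ Finset.range n, commFactor r k * ‖Γ k (t - l * s)‖ₑ := by
        simp_rw [← Finset.mul_sum]
        gcongr with k
        exact orbitSup_le_sum hn hper k t
    _ = ∑ l ∈ Finset.range n, ∑' k, commFactor r k * ‖Γ k (t - l * s)‖ₑ :=
        Summable.tsum_finsetSum fun _ _ => ENNReal.summable
    _ ≤ ∑ _l ∈ Finset.range n, ((δ * C + δ : ℝ≥0) : ℝ≥0∞) := by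
        refine Finset.sum_le_sum fun l _ => (tsum_commFactor_mul_le hr.le hrK).trans ?_
        push_cast
        gcongr
        · exact_mod_cast hrow l
        · simpa using htail l
    _ ≤ ε := by
        rw [Finset.sum_const, Finset.card_range, nsmul_eq_mul]
        exact_mod_cast hδε

theorem exists_tsum_pow_natAbs_le (hr : r < 1) :
    ∃ D : ℝ≥0, 0 < D ∧ ∑' j : ℤ, ((r ^ j.natAbs : ℝ≥0) : ℝ≥0∞) ≤ D := by
  have hgeom : Summable fun n : ℕ => (r : ℝ) ^ n :=
    summable_geometric_of_lt_one r.coe_nonneg (by exact_mod_cast hr)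
  have hs : Summable fun j : ℤ => r ^ j.natAbs := by
    rw [← NNReal.summable_coe]
    exact Summable.of_nat_of_neg (by simpa using hgeom) (by simpa using hgeom)
  exact ⟨∑' j : ℤ, r ^ j.natAbs + 1, by positivity,
    (ENNReal.coe_tsum hs).symm.trans_le (by exact_mod_cast le_self_add)⟩

theorem IsSchurKernel.mul_eLpNorm_le_of_mul_norm_le {p : ℝ≥0∞} [Fact (1 ≤ p)]
    (hΓ : IsSchurKernel s Γ C) {c : ℝ≥0} (h : ∀ u, c * ‖u‖ ≤ ‖hΓ.toCLM p u‖) {φ : ℝ → ℂ}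
    (hφ : MemLp φ p) : c * eLpNorm φ p ≤ eLpNorm (kerSum s Γ φ) p := by
  have hle : c * ‖hφ.toLp‖ ≤ (1 : ℝ≥0) * ‖hΓ.toCLM p hφ.toLp‖ := by
    simpa only [NNReal.coe_one, one_mul] using h hφ.toLp
  simpa only [ENNReal.coe_one, one_mul] using (mul_norm_le_mul_norm_iff hφ.coeFn_toLp
    ((hΓ.toCLM_ae _).trans (kerSum_congr_ae hφ.coeFn_toLp))).1 hle

theorem IsSchurKernel.exists_mul_norm_le (hΓ : IsSchurKernel s Γ C) (hs : 0 < s) {n : ℕ}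
    (hn : 0 < n) (hper : ∀ k, Function.Periodic (Γ k) (n * s)) (htight : TightRows Γ) {c : ℝ≥0}
    (hc : 0 < c)
    (hlow : ∀ lam : ℝ, 0 ≤ lam → ∀ u : LTwo, c * ‖u‖ ≤ ‖hΓ.toCLM 2 u + (lam : ℂ) • u‖) :
    ∃ c' : ℝ, 0 < c' ∧ ∀ (p : ℝ≥0∞) [Fact (1 ≤ p)], ∀ lam : ℝ, 0 ≤ lam →
      ∀ u ∈ closure (bddSuppClasses p), c' * ‖u‖ ≤ ‖hΓ.toCLM p u + (lam : ℂ) • u‖ := by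
  set ε : ℝ≥0 := c / 4
  have hε : 0 < ε := by positivity
  obtain ⟨r, hr, hrow⟩ := exists_tsum_commFactor_mul_orbitSup_le hn hper hΓ.row htight hε
  obtain ⟨D, hD0, hD⟩ := exists_tsum_pow_natAbs_le hr
  refine ⟨2 * ε / D, by positivity, fun p _ lam hlam u hu => ?_⟩
  have hL2 : ∀ φ : ℝ → ℂ, MemLp φ 2 → ((4 * ε : ℝ≥0) : ℝ≥0∞) * eLpNorm φ 2
      ≤ eLpNorm (kerSum s (WeylHeisenberg.addDiag Γ lam) φ) 2 := by
    refine fun φ hφ => (hΓ.addDiag lam).mul_eLpNorm_le_of_mul_norm_le (fun u => ?_) hφ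
    simpa only [hΓ.toCLM_addDiag, ε, mul_div_cancel₀ c four_ne_zero] using hlow lam hlam u
  have hLp : ∀ f M R, BddSupp f M R →
      ((2 * ε : ℝ≥0) : ℝ≥0∞) * eLpNorm f p
        ≤ D * eLpNorm (kerSum s (WeylHeisenberg.addDiag Γ lam) f) p := by
    intro f M R hf
    push_cast
    exact (hΓ.addDiag lam).mul_eLpNorm_le hs hr.le hD hL2
      (ae_of_all _ fun t j k => commFactor_mul_enorm_addDiag_le _ j k t)
      (fun k => (measurable_orbitSup hΓ.meas k).const_mul _) hrow
      (by simpa only [orbitSup_add_mul] using hrow) Fact.out hf.meas (hf.memLp 2) (hf.memLp p)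
  rw [← hΓ.toCLM_addDiag, div_mul_eq_mul_div, div_le_iff₀' (by exact_mod_cast hD0)]
  exact_mod_cast (hΓ.addDiag lam).mul_norm_le_of_bddSupp hLp hu

end Majorant

/-! ### From the uniform CC-condition to the CC-condition -/

section EntryBound

variable {s : ℝ} {Γ : ℤ → ℝ → ℂ} {E : Set ℝ} {J k : ℤ}

/-- The indicator function of the translate `E - k s`. -/
noncomputable def shiftIndicator (s : ℝ) (E : Set ℝ) (k : ℤ) (x : ℝ) : ℂ :=
  E.indicator (fun _ => 1) (x + k * s)

theorem kerSum_shiftIndicator (hs : s ≠ 0) (hE : E ⊆ {t | ⌈t / s⌉ = J}) {t : ℝ} (ht : t ∈ E) :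
    kerSum s Γ (shiftIndicator s E k) t = Γ k t := by
  have hzero : ∀ l, l ≠ k → Γ l t * shiftIndicator s E k (t - l * s) = 0 := by
    intro l hl
    rw [shiftIndicator, Set.indicator_of_notMem, mul_zero]
    intro hmem
    have hceil : ⌈(t - l * s + k * s) / s⌉ = J := hE hmem
    have htJ : ⌈t / s⌉ = J := hE ht
    rw [show t - l * s + k * s = t - (l - k : ℤ) * s by push_cast; ring, ceil_sub_mul_div hs,
      htJ] at hceil
    omega
  rw [kerSum, tsum_eq_single k hzero, shiftIndicator, sub_add_cancel, Set.indicator_of_mem ht,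
    mul_one]

theorem exists_bddSupp_shiftIndicator (hE : MeasurableSet E) (hEb : Bornology.IsBounded E) :
    ∃ R, BddSupp (shiftIndicator s E k) 1 R := by
  obtain ⟨R, hR⟩ := hEb.subset_closedBall 0
  refine ⟨R + |k * s|, (measurable_const.indicator hE).comp (measurable_add_const _),
    fun t => (enorm_indicator_le_enorm_self _ _).trans (by simp), fun t ht => ?_⟩
  refine Set.indicator_of_notMem (fun hmem => ht.not_ge ?_) _
  have hle : |t + k * s| ≤ R := by simpa using hR hmem
  linarith [abs_sub_abs_le_abs_add t (k * s)]

theorem eLpNorm_two_shiftIndicator_sq (hE : MeasurableSet E) :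
    eLpNorm (shiftIndicator s E k) 2 ^ 2 = volume E := by
  have hcomp : eLpNorm (shiftIndicator s E k) 2 = eLpNorm (E.indicator fun _ => (1 : ℂ)) 2 :=
    eLpNorm_comp_measurePreserving (measurable_const.indicator hE).aestronglyMeasurable
      (measurePreserving_add_right volume (k * s))
  rw [hcomp, eLpNorm_two_sq, ← lintegral_indicator_one hE]
  congr 1 with t
  by_cases ht : t ∈ E <;> simp [ht]

theorem isBounded_ceil_div_eq (hs : 0 < s) (J : ℤ) :
    Bornology.IsBounded {t : ℝ | ⌈t / s⌉ = J} := by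
  refine (Metric.isBounded_Icc ((J - 1) * s) (J * s)).subset fun t ht => ?_
  obtain ⟨hlo, hhi⟩ := Int.ceil_eq_iff.1 ht
  exact ⟨((lt_div_iff₀ hs).1 hlo).le, (div_le_iff₀ hs).1 hhi⟩

theorem ae_enorm_le_of_eLpNorm_kerSum_le (hs : 0 < s) (hΓ : ∀ k, Measurable (Γ k)) {C : ℝ≥0}
    (h : ∀ f M R, BddSupp f M R → eLpNorm (kerSum s Γ f) 2 ≤ C * eLpNorm f 2) (k : ℤ) :
    ∀ᵐ t : ℝ, ‖Γ k t‖ₑ ≤ C := by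
  have hcell (J : ℤ) : ∀ᵐ t ∂volume.restrict {t : ℝ | ⌈t / s⌉ = J},
      ‖Γ k t‖ₑ ^ 2 ≤ (C : ℝ≥0∞) ^ 2 := by
    refine ae_le_of_forall_setLIntegral_le_of_sigmaFinite ((hΓ k).enorm.pow_const 2)
      fun E hE _ => ?_
    rw [Measure.restrict_restrict hE, setLIntegral_const]
    set E' := E ∩ {t | ⌈t / s⌉ = J}
    have hE' : MeasurableSet E' := hE.inter (measurableSet_ceil_eq s J)
    obtain ⟨R, hf⟩ := exists_bddSupp_shiftIndicator (s := s) (k := k) hE'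
      ((isBounded_ceil_div_eq hs J).subset Set.inter_subset_right)
    calc ∫⁻ t in E', ‖Γ k t‖ₑ ^ 2
        = ∫⁻ t in E', ‖kerSum s Γ (shiftIndicator s E' k) t‖ₑ ^ 2 :=
          setLIntegral_congr_fun hE' fun t ht => by
            rw [kerSum_shiftIndicator hs.ne' Set.inter_subset_right ht]
      _ ≤ eLpNorm (kerSum s Γ (shiftIndicator s E' k)) 2 ^ 2 := by
          rw [eLpNorm_two_sq]
          exact setLIntegral_le_lintegral _ _
      _ ≤ (C * eLpNorm (shiftIndicator s E' k) 2) ^ 2 := by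
          gcongr
          exact h _ _ _ hf
      _ = C ^ 2 * volume E' := by rw [mul_pow, eLpNorm_two_shiftIndicator_sq hE']
  filter_upwards [ae_all_iff.2 fun J => (ae_restrict_iff' (measurableSet_ceil_eq s J)).1 (hcell J)]
    with t ht
  exact (ENNReal.pow_le_pow_left_iff two_ne_zero).1 (ht _ rfl)

end EntryBound

theorem IsFrame.exists_isBessel {ι H : Type*} [NormedAddCommGroup H] [InnerProductSpace ℂ H]
    {v : ι → H} (hv : IsFrame v) : ∃ B, IsBessel v B := by
  obtain ⟨A, B, -, hAB⟩ := hv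
  refine ⟨B.toNNReal, fun f F => ?_⟩
  calc ∑ i ∈ F, ‖inner ℂ (v i) f‖ ^ 2 ≤ ∑' i, ‖inner ℂ (v i) f‖ ^ 2 :=
        (hAB f).1.sum_le_tsum F fun _ _ => sq_nonneg _
    _ ≤ B * ‖f‖ ^ 2 := (hAB f).2.2
    _ ≤ B.toNNReal * ‖f‖ ^ 2 := by gcongr; exact Real.le_coe_toNNReal B

section UniformCC

variable {a b : ℝ} {g : LTwo}

theorem IsBessel.ae_enorm_autoCorr_le (ha : 0 < a) (hb : 0 < b) {B : ℝ≥0}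
    (hB : IsBessel (whSystem a b g) B) (k : ℤ) :
    ∀ᵐ t : ℝ, ‖autoCorr a b g k t‖ₑ ≤ (‖b‖₊ * ‖hB.frameOp‖₊ : ℝ≥0) := by
  refine ae_enorm_le_of_eLpNorm_kerSum_le (inv_pos.2 hb) (measurable_autoCorr (measurable_coeFn g))
    (fun f M R hf => ?_) k
  have hu := (hf.memLp 2).coeFn_toLp
  have hb' : (b : ℂ) ≠ 0 := by exact_mod_cast hb.ne'
  have hval := IsFrameOpValue.ae_eq ha hb (hB.hasSum_frameOp _) hf hu
  have hker : kerSum b⁻¹ (autoCorr a b g) f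
      =ᵐ[volume] ((b : ℂ) • hB.frameOp (hf.memLp 2).toLp : LTwo) := by
    filter_upwards [hval, Lp.coeFn_smul (b : ℂ) (hB.frameOp (hf.memLp 2).toLp)] with t h1 h2
    rw [h2, Pi.smul_apply, h1, smul_eq_mul, mul_inv_cancel_left₀ hb']
  rw [eLpNorm_congr_ae hker, ← eLpNorm_congr_ae hu, ← Lp.enorm_def, ← Lp.enorm_def]
  set u : LTwo := (hf.memLp 2).toLp
  have hnorm : ‖(b : ℂ) • hB.frameOp u‖₊ ≤ ‖b‖₊ * ‖hB.frameOp‖₊ * ‖u‖₊ := by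
    rw [nnnorm_smul, Complex.nnnorm_real, mul_assoc]
    gcongr
    exact hB.frameOp.le_opNNNorm u
  rw [enorm_eq_nnnorm, enorm_eq_nnnorm, ← ENNReal.coe_mul]
  exact ENNReal.coe_le_coe.2 hnorm

theorem UniformCCCondition.tightRows (hU : UniformCCCondition a b g) :
    TightRows (autoCorr a b g) := fun ε hε =>
  let ⟨K, _, hK⟩ := hU ε hε
  ⟨K, hK.mono fun _ ht => ht.le⟩

theorem TightRows.exists_tsum_le {Γ : ℤ → ℝ → ℂ} (hΓ : TightRows Γ) {C : ℝ≥0}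
    (hC : ∀ k, ∀ᵐ t : ℝ, ‖Γ k t‖ₑ ≤ C) : ∃ D : ℝ≥0, ∀ᵐ t : ℝ, ∑' k, ‖Γ k t‖ₑ ≤ D := by
  obtain ⟨K, hK⟩ := hΓ 1 one_pos
  have hcompl : ((Finset.Ioo (-K : ℤ) K : Set ℤ))ᶜ = {k : ℤ | (K : ℤ) ≤ |k|} := by
    ext k
    simp [← abs_lt]
  refine ⟨((Finset.Ioo (-K : ℤ) K).card : ℝ≥0) * C + 1, ?_⟩
  filter_upwards [ae_all_iff.2 hC, hK] with t hle htail
  calc ∑' k, ‖Γ k t‖ₑ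
      = ∑ k ∈ Finset.Ioo (-K : ℤ) K, ‖Γ k t‖ₑ
        + ∑' k : ((Finset.Ioo (-K : ℤ) K : Set ℤ)ᶜ : Set ℤ), ‖Γ k t‖ₑ :=
        (ENNReal.sum_add_tsum_compl _ _).symm
    _ ≤ (Finset.Ioo (-K : ℤ) K).card • (C : ℝ≥0∞) + ENNReal.ofReal 1 := by
        rw [hcompl]
        exact add_le_add (Finset.sum_le_card_nsmul _ _ _ fun k _ => hle k) htail
    _ = (((Finset.Ioo (-K : ℤ) K).card : ℝ≥0) * C + 1 : ℝ≥0) := by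
        rw [nsmul_eq_mul, ENNReal.ofReal_one, ENNReal.coe_add, ENNReal.coe_mul,
          ENNReal.coe_natCast, ENNReal.coe_one]

end UniformCC

/-! ### Isomorphic extensions of the frame operator -/

section Isomorphism

variable {a b : ℝ} {g : LTwo}

theorem autoCorr_periodic (g : ℝ → ℂ) {c : ℝ} {m : ℤ} (hc : c = m * a) (k : ℤ) :
    Function.Periodic (autoCorr a b g k) c := by
  intro t
  rw [autoCorr, autoCorr, ← (Equiv.addRight m).tsum_eq]
  refine tsum_congr fun n => ?_
  have hshift : t + c - ((n + m : ℤ) : ℝ) * a = t - n * a := by rw [hc]; push_cast; ring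
  simp only [Equiv.coe_addRight, hshift]

theorem exists_pos_nat_mul_inv_eq (ha : 0 < a) (hb : 0 < b) {q : ℚ} (hq : a * b = q) :
    ∃ (n : ℕ) (m : ℤ), 0 < n ∧ n * b⁻¹ = m * a := by
  have hq0 : 0 < q := by exact_mod_cast hq ▸ mul_pos ha hb
  have hnum : ((q.num.toNat : ℤ) : ℝ) = q * q.den := by
    rw [Int.toNat_of_nonneg (Rat.num_nonneg.2 hq0.le)]
    exact_mod_cast (Rat.mul_den_eq_num q).symm
  refine ⟨q.num.toNat, q.den, Int.lt_toNat.2 (Rat.num_pos.2 hq0), ?_⟩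
  rw [← Int.cast_natCast, hnum, ← hq, Int.cast_natCast]
  field_simp

theorem exists_equiv_eq_smul {E : Type*} [NormedAddCommGroup E] [NormedSpace ℂ E]
    [CompleteSpace E] {T : E →L[ℂ] E} {c : ℝ} (hc : 0 < c)
    (h : ∀ lam : ℝ, 0 ≤ lam → ∀ x, c * ‖x‖ ≤ ‖T x + (lam : ℂ) • x‖) {z : ℂ} (hz : z ≠ 0) :
    ∃ e : E ≃L[ℂ] E, ∀ x, e x = z • T x :=
  let ⟨e, he⟩ := (isUnit_of_forall_le_norm_add_smul hc h).smul (Units.mk0 z hz)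
  ⟨ContinuousLinearEquiv.unitsEquiv ℂ E e, fun x => DFunLike.congr_fun he x⟩

theorem exists_equiv_extendsFrameOp (ha : 0 < a) (hb : 0 < b) (hq : ∃ q : ℚ, a * b = q)
    (hfr : IsFrame (whSystem a b g)) (hU : UniformCCCondition a b g) :
    (∀ (p : ℝ≥0∞) [Fact (1 ≤ p)], p ≠ ∞ →
      ∃ T : Lp ℂ p (volume : Measure ℝ) ≃L[ℂ] Lp ℂ p (volume : Measure ℝ),
        ExtendsFrameOp a b g id T) ∧
    ∃ T : LInftyZero ≃L[ℂ] LInftyZero,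
      ExtendsFrameOp a b g Subtype.val (fun f => (T f).val) := by
  obtain ⟨B, hB⟩ := hfr.exists_isBessel
  obtain ⟨C, hC⟩ := hU.tightRows.exists_tsum_le (hB.ae_enorm_autoCorr_le ha hb)
  have hG := isSchurKernel_autoCorr (measurable_coeFn g) hC
  obtain ⟨q, hq⟩ := hq
  obtain ⟨n, m, hn, hnm⟩ := exists_pos_nat_mul_inv_eq ha hb hq
  obtain ⟨c, hc, hlow⟩ := hG.exists_mul_norm_le_of_isFrame ha hb hfr
  obtain ⟨c', hc', hlow'⟩ :=
    hG.exists_mul_norm_le (inv_pos.2 hb) hn (autoCorr_periodic g hnm) hU.tightRows hc hlow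
  have hb' : (b : ℂ)⁻¹ ≠ 0 := inv_ne_zero (by exact_mod_cast hb.ne')
  constructor
  · intro p _ hp
    obtain ⟨e, he⟩ := exists_equiv_eq_smul hc'
      (fun lam hlam u => hlow' p lam hlam u (dense_bddSuppClasses hp u)) hb'
    exact ⟨e, hG.extendsFrameOp ha hb he⟩
  · have : CompleteSpace LInftyZero :=
      (Submodule.isClosed_topologicalClosure _).completeSpace_coe
    let T : LInftyZero →L[ℂ] LInftyZero := (hG.toCLM ∞ ∘L LInftyZero.subtypeL).codRestrict
      LInftyZero fun f => hG.toCLM_mem_LInftyZero hU.tightRows f.2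
    obtain ⟨e, he⟩ := exists_equiv_eq_smul (T := T) hc'
      (fun lam hlam u => hlow' ∞ lam hlam u (LInftyZero_subset_closure_bddSuppClasses u.2)) hb'
    exact ⟨e, hG.extendsFrameOp ha hb fun f => congrArg Subtype.val (he f)⟩

end Isomorphism

end WeylHeisenberg

theorem theorem7p1_general (a b : ℝ) (ha : 0 < a) (hb : 0 < b)
    (g : Lp ℂ 2 (volume : Measure ℝ)) :
    (WeylHeisenberg.CCCondition a b g ↔
      (∀ (p : ℝ≥0∞) [Fact (1 ≤ p)], p ≠ ∞ →
        ∃ T : Lp ℂ p (volume : Measure ℝ) →L[ℂ] Lp ℂ p (volume : Measure ℝ),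
          WeylHeisenberg.ExtendsFrameOp a b g id T) ∧
      (∃ T : WeylHeisenberg.LInftyZero →L[ℂ] Lp ℂ ∞ (volume : Measure ℝ),
        WeylHeisenberg.ExtendsFrameOp a b g Subtype.val T)) ∧
    ((∃ q : ℚ, a * b = q) → WeylHeisenberg.IsFrame (WeylHeisenberg.whSystem a b g) →
      WeylHeisenberg.UniformCCCondition a b g →
      (∀ (p : ℝ≥0∞) [Fact (1 ≤ p)], p ≠ ∞ →
        ∃ T : Lp ℂ p (volume : Measure ℝ) ≃L[ℂ] Lp ℂ p (volume : Measure ℝ),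
          WeylHeisenberg.ExtendsFrameOp a b g id T) ∧
      (∃ T : WeylHeisenberg.LInftyZero ≃L[ℂ] WeylHeisenberg.LInftyZero,
        WeylHeisenberg.ExtendsFrameOp a b g Subtype.val (fun f => (T f).val))) :=
  ⟨WeylHeisenberg.ccCondition_iff ha hb g, WeylHeisenberg.exists_equiv_extendsFrameOp ha hb⟩

theorem theorem7p1 (a b : ℝ) (ha : 0 < a) (hb : 0 < b) (hab : a * b ≤ 1)
    (g : Lp ℂ 2 (volume : Measure ℝ)) :
    (WeylHeisenberg.CCCondition a b g ↔
      (∀ (p : ℝ≥0∞) [Fact (1 ≤ p)], p ≠ ∞ →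
        ∃ T : Lp ℂ p (volume : Measure ℝ) →L[ℂ] Lp ℂ p (volume : Measure ℝ),
          WeylHeisenberg.ExtendsFrameOp a b g id T) ∧
      (∃ T : WeylHeisenberg.LInftyZero →L[ℂ] Lp ℂ ∞ (volume : Measure ℝ),
        WeylHeisenberg.ExtendsFrameOp a b g Subtype.val T)) ∧
    ((∃ q : ℚ, a * b = q) → WeylHeisenberg.IsFrame (WeylHeisenberg.whSystem a b g) →
      WeylHeisenberg.UniformCCCondition a b g →
      (∀ (p : ℝ≥0∞) [Fact (1 ≤ p)], p ≠ ∞ →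
        ∃ T : Lp ℂ p (volume : Measure ℝ) ≃L[ℂ] Lp ℂ p (volume : Measure ℝ),
          WeylHeisenberg.ExtendsFrameOp a b g id T) ∧
      (∃ T : WeylHeisenberg.LInftyZero ≃L[ℂ] WeylHeisenberg.LInftyZero,
        WeylHeisenberg.ExtendsFrameOp a b g Subtype.val (fun f => (T f).val))) :=
  theorem7p1_general a b ha hb g
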